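/- **Setting.** Let $n\ge 1$, $d=2^n$, and let $U_\theta$ be an $n$-qubit Pauli-encoded parametrized circuit with parameters $\theta=(\theta_1,\dots,\theta_m)$: a product of single-qubit Pauli rotations $e^{-i\theta_k P_k/2}$, $P_k\in\{X,Y,Z\}$, interleaved with fixed unitaries. Let $O$ be a traceless $n$-qubit Pauli string and $f(\theta)=\langle 0|U_\theta^\dagger O U_\theta|0\rangle$. We consider a gradient component $\partial_k f$, a diagonal Hessian component $\partial_k^2 f$, or an off-diagonal Hessian component $\partial_k\partial_l f$ ($k\ne l$). Averages $\langle\cdot\rangle$ over $\theta$ are taken with respect to a probability law that satisfies the two-design-sandwich (TDS) condition for the component: the circuit operators before and after the encoded gate (for $k\neq l$: before the first, between the two, and after the second of the encoded gates) are unitary two-designs, i.e. their first and second moments ($V\otimes V^*$ and $V^{\otimes2}\otimes V^{*\otimes2}$) coincide with those of the Haar measure, and the parameters in these operators and the parameters of the encoded gates are independent of each other. (Then $U_\theta$ is itself a two-design.) The noisy output states are $\rho_{\theta,\eta}=(1-\eta)U_\theta|0\rangle\langle 0|U_\theta^\dagger+\eta\rho_{\rm err}$ with error rate $0\le\eta\le1$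 and a density operator $\rho_{\rm err}$ that does not depend on $\theta$, so that $f_\eta=(1-\eta)f+\eta g$ with $g={\rm tr}(\rho_{\rm err}O)\in[-1,1]$. **Estimators.** Each function value is estimated by the average of the eigenvalues found when $N\ge1$ copies are measured in an eigenbasis of $O$, with independent data for different values. The parameter-shift (PS) estimators insert these into $\frac12[f(\theta_k+\frac\pi2)-f(\theta_k-\frac\pi2)]$, $\frac14[f(\theta_k+\pi)-2f(\theta_k)+f(\theta_k-\pi)]$ and $\frac14\sum_{a,b=\pm1}ab\,f(\theta_k+a\frac\pi2,\theta_l+b\frac\pi2)$, so that the total copy number is $N_{\rm T}=2N,3N,4N$ respectively. The scaled (SPS) estimators are $\lambda$ times the PS estimators. The MSE is the mean squared deviation from the noiseless component, averaged over the data and over $\theta$. NSPS is SPS with $$\lambda_{\rm opt}=\frac{dN_{\rm T}}{2d^2+dN_{\rm T}-2},\qquad \frac{4dN_{\rm T}}{9d^2+4dN_{\rm T}-9},\qquad \frac{d^3N_{\rm T}}{4(d^2-1)^2+d^3N_{\rm T}}$$ for the gradient, diagonal and off-diagonal Hessian components respectively. **Claim.** For each of the three kinds of components: 1. $\lambda_{\rm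 opt}$ is the unique minimizer over $\lambda\in\mathbb R$ of the SPS MSE for the noiseless circuit. 2. For $0<\eta<1$ there is a critical number $N_*>0$, depending only on the kind of the component, $n$, $\eta$ and $g$, such that ${\rm MSE}_{\rm NSPS}<{\rm MSE}_{\rm PS}$ if and only if $N_{\rm T}<N_*$, and ${\rm MSE}_{\rm NSPS}={\rm MSE}_{\rm PS}$ if and only if $N_{\rm T}=N_*$. Explicitly, $N_*$ is $$\frac{(d^2-1)h}{2d^2\eta(1-\eta)},\qquad \frac{9(d^2-1)h}{16d^2\eta(1-\eta)},\qquad \frac{(d^2-1)^2h}{d^4\eta(1-\eta)}$$ respectively, where $h=b+\sqrt{b^2+8d\eta(1-\eta)q}$, $q=d+2\eta-\eta^2-(d+1)\eta^2g^2$, $b=2q-d(1-\eta^2)$. If $\eta=0$, or if $\eta=1$ and $|g|<1$, then ${\rm MSE}_{\rm NSPS}<{\rm MSE}_{\rm PS}$ for all $N_{\rm T}$. 3. If $g=0$, then $$h=d+4\eta+\eta^2(d-2)+\Big\{4\eta^2(2-\eta)^2+4d\eta[2+\eta(1-\eta)(3-\eta)]+d^2[1+\eta(8-6\eta+\eta^3)]\Big\}^{1/2}.$$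 4. To leading order in small $\eta$, $N_*$ is respectively $$\frac{d^2-1}{d\eta},\qquad\frac{9(d^2-1)}{8d\eta},\qquad\frac{2(d^2-1)^2}{d^3\eta},$$ with an error of at most $C\,2^n$ for all $n\ge1$, $0<\eta\le\frac12$ and $|g|\le1$, where $C$ is a universal constant. 5. $N_*$ grows as $2^n/\eta$: there are universal constants $c_1,c_2>0$ with $c_1\,2^n/\eta\le N_*\le c_2\,2^n/(\eta(1-\eta))$ for all $n\ge1$, $0<\eta<1$ and $|g|\le1$; in particular $N_*=O(2^n/\eta)$ uniformly for $\eta$ bounded away from $1$. -/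

import Mathlib

open MeasureTheory ProbabilityTheory Matrix
open scoped ComplexOrder

/-! ### Qubits and Pauli operators -/

/-- The index set of the computational basis of `n` qubits; it has `2 ^ n` elements. -/
abbrev Qubits (n : ℕ) : Type := Fin n → Fin 2

/-- Operators on the Hilbert space of `n` qubits, in the computational basis. -/
abbrev Op (n : ℕ) : Type := Matrix (Qubits n) (Qubits n) ℂ

/-- The three standard single-qubit Pauli labels. -/
inductive Axis : Type
  | X
  | Y
  | Z

/-- The standard Pauli matrices `σ_x`, `σ_y`, `σ_z`. -/
noncomputable def Axis.sigma : Axis → Matrix (Fin 2) (Fin 2) ℂ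
  | .X => !![0, 1; 1, 0]
  | .Y => !![0, -Complex.I; Complex.I, 0]
  | .Z => !![1, 0; 0, -1]

/-- The single-qubit factor of a Pauli string; `none` stands for the identity. -/
noncomputable def pauliFactor : Option Axis → Matrix (Fin 2) (Fin 2) ℂ
  | none => 1
  | some a => a.sigma

/-- The `n`-qubit Pauli operator `σ_{s 0} ⊗ σ_{s 1} ⊗ ⋯ ⊗ σ_{s (n-1)}`. It is traceless exactly
when some factor `s q` is not the identity. -/
noncomputable def pauliString {n : ℕ} (s : Fin n → Option Axis) : Op n :=
  Matrix.of fun x y => ∏ q, pauliFactor (s q) (x q) (y q)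

/-- The single-qubit Pauli operator `σ_a` acting on qubit `q`. -/
noncomputable def singlePauli {n : ℕ} (q : Fin n) (a : Axis) : Op n :=
  pauliString (Function.update (fun _ => none) q (some a))

/-- The Pauli rotation gate `exp(-i t P / 2) = cos(t/2) 1 - i sin(t/2) P`, for `P ^ 2 = 1`. -/
noncomputable def pauliRotation {n : ℕ} (P : Op n) (t : ℝ) : Op n :=
  (Real.cos (t / 2) : ℂ) • (1 : Op n) - (Complex.I * (Real.sin (t / 2) : ℂ)) • P

/-! ### Unitary two-designs -/

noncomputable instance unitaryMeasurableSpace (n : ℕ) :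
    MeasurableSpace (Matrix.unitaryGroup (Qubits n) ℂ) := borel _

instance unitaryBorelSpace (n : ℕ) : BorelSpace (Matrix.unitaryGroup (Qubits n) ℂ) := ⟨rfl⟩

instance unitaryCompactSpace (n : ℕ) : CompactSpace (Matrix.unitaryGroup (Qubits n) ℂ) := by
  suffices h : IsCompact (Matrix.unitaryGroup (Qubits n) ℂ : Set (Op n)) from
    isCompact_iff_compactSpace.mp h
  have hK : IsCompact (Set.univ.pi fun _ : Qubits n => Set.univ.pi fun _ : Qubits n =>
      Metric.closedBall (0 : ℂ) 1) :=
    isCompact_univ_pi fun _ => isCompact_univ_pi fun _ => isCompact_closedBall _ _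
  have hcl : IsClosed {U : Op n | star U * U = 1 ∧ U * star U = 1} :=
    (isClosed_eq (by fun_prop) continuous_const).inter
      (isClosed_eq (by fun_prop) continuous_const)
  refine IsCompact.of_isClosed_subset hK hcl ?_
  exact fun U hU i _ j _ => mem_closedBall_zero_iff.mpr (entry_norm_bound_of_unitary hU i j)

/-- The normalized Haar measure of the unitary group of `n` qubits. -/
noncomputable def unitaryHaar (n : ℕ) : Measure (Matrix.unitaryGroup (Qubits n) ℂ) :=
  Measure.haarMeasure ⊤

/-- The random unitary operator `V`, under the law `μ`, is a unitary two-design: the first moments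
of `V ⊗ V*` and the second moments of `V ⊗ V*` coincide with those of the Haar measure. -/
def IsTwoDesign {Ω : Type*} [MeasurableSpace Ω] {n : ℕ} (μ : Measure Ω) (V : Ω → Op n) : Prop :=
  (∀ i j k l : Qubits n,
    ∫ ω, V ω i j * star (V ω k l) ∂μ =
      ∫ U : Matrix.unitaryGroup (Qubits n) ℂ,
        (U : Op n) i j * star ((U : Op n) k l) ∂(unitaryHaar n)) ∧
  (∀ i₁ j₁ i₂ j₂ k₁ l₁ k₂ l₂ : Qubits n,
    ∫ ω, V ω i₁ j₁ * V ω i₂ j₂ * star (V ω k₁ l₁) * star (V ω k₂ l₂) ∂μ =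
      ∫ U : Matrix.unitaryGroup (Qubits n) ℂ,
        (U : Op n) i₁ j₁ * (U : Op n) i₂ j₂ * star ((U : Op n) k₁ l₁) * star ((U : Op n) k₂ l₂)
          ∂(unitaryHaar n))

/-! ### Pauli-encoded parametrized quantum circuits -/

/-- A Pauli-encoded parametrized quantum circuit on `n` qubits with `m` parameters
`θ 0, …, θ (m-1)`, numbered in the order in which they act. Parameter `i` is encoded on the
single-qubit Pauli rotation about `axis i` of qubit `qubit i`, and the rotations are interleaved
with parameter-independent unitary operators `fixed 0, …, fixed m`; the circuit unitary is
`fixed m * R_{m-1}(θ_{m-1}) * fixed (m-1) * ⋯ * fixed 1 * R_0(θ_0) * fixed 0`.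
Only the values `fixed 0, …, fixed m` are used. -/
structure PauliCircuit (n m : ℕ) where
  qubit : Fin m → Fin n
  axis : Fin m → Axis
  fixed : ℕ → Matrix.unitaryGroup (Qubits n) ℂ

namespace PauliCircuit

variable {n m : ℕ}

/-- The encoded gate with number `i` (there is no gate for `i ≥ m`). -/
noncomputable def gate (c : PauliCircuit n m) (θ : Fin m → ℝ) (i : ℕ) : Op n :=
  if h : i < m then pauliRotation (singlePauli (c.qubit ⟨i, h⟩) (c.axis ⟨i, h⟩)) (θ ⟨i, h⟩) else 1

/-- The circuit segment that contains the `len` encoded gates `a, …, a + len - 1` and the fixed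
operators `fixed a, …, fixed (a + len)` around them. -/
noncomputable def segment (c : PauliCircuit n m) (θ : Fin m → ℝ) (a : ℕ) : ℕ → Op n
  | 0 => (c.fixed a : Op n)
  | len + 1 => (c.fixed (a + len + 1) : Op n) * c.gate θ (a + len) * c.segment θ a len

/-- The circuit unitary `U_θ`. -/
noncomputable def unitary (c : PauliCircuit n m) (θ : Fin m → ℝ) : Op n :=
  c.segment θ 0 m

/-- The noiseless output state `U_θ |0⟩⟨0| U_θ†`. -/
noncomputable def state (c : PauliCircuit n m) (θ : Fin m → ℝ) : Op n :=
  c.unitary θ * Matrix.single 0 0 1 * (c.unitary θ)ᴴ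

/-- The noiseless circuit function `f(θ) = ⟨0| U_θ† O U_θ |0⟩`. -/
noncomputable def value (c : PauliCircuit n m) (O : Op n) (θ : Fin m → ℝ) : ℝ :=
  (((c.unitary θ)ᴴ * O * c.unitary θ) 0 0).re

end PauliCircuit

/-! ### Gradient and Hessian components -/

/-- The `k`-th partial derivative of a function of `m` real parameters. -/
noncomputable def partialDeriv {m : ℕ} (k : Fin m) (f : (Fin m → ℝ) → ℝ) (θ : Fin m → ℝ) : ℝ :=
  deriv (fun t => f (Function.update θ k t)) (θ k)

/-- The three kinds of components that are estimated. -/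
inductive Kind : Type
  | gradient
  | diagHessian
  | offDiagHessian

/-- A gradient component, a diagonal or an off-diagonal Hessian component. -/
inductive Component (m : ℕ) : Type
  | gradient (k : Fin m)
  | diagHessian (k : Fin m)
  | offDiagHessian (k l : Fin m) (h : k ≠ l)

/-- A linear combination of translated function values: `∑ a, weight a * f (θ + shift a)`. -/
structure Stencil (m : ℕ) where
  size : ℕ
  weight : Fin size → ℝ
  shift : Fin size → Fin m → ℝ

namespace Component

variable {n m : ℕ}

/-- The kind of a component. -/
def kind : Component m → Kind
  | gradient _ => .gradient
  | diagHessian _ => .diagHessian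
  | offDiagHessian _ _ _ => .offDiagHessian

/-- The true component of a function `f`. -/
noncomputable def trueValue (f : (Fin m → ℝ) → ℝ) : Component m → (Fin m → ℝ) → ℝ
  | gradient k => partialDeriv k f
  | diagHessian k => partialDeriv k (partialDeriv k f)
  | offDiagHessian k l _ => partialDeriv k (partialDeriv l f)

/-- The parameter-shift rule of a component. The function is sampled at `2`, `3` and `4` points
for gradient, diagonal-Hessian and off-diagonal-Hessian components. -/
noncomputable def stencil : Component m → Stencil m
  | gradient k =>
    { size := 2
      weight := ![1 / 2, -1 / 2]
      shift := ![Pi.single k (Real.pi / 2), Pi.single k (-Real.pi / 2)] }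
  | diagHessian k =>
    { size := 3
      weight := ![1 / 4, -1 / 2, 1 / 4]
      shift := ![Pi.single k Real.pi, 0, Pi.single k (-Real.pi)] }
  | offDiagHessian k l _ =>
    { size := 4
      weight := ![1 / 4, -1 / 4, -1 / 4, 1 / 4]
      shift := ![Pi.single k (Real.pi / 2) + Pi.single l (Real.pi / 2),
        Pi.single k (Real.pi / 2) + Pi.single l (-Real.pi / 2),
        Pi.single k (-Real.pi / 2) + Pi.single l (Real.pi / 2),
        Pi.single k (-Real.pi / 2) + Pi.single l (-Real.pi / 2)] }

end Component

/-! ### The two-design-sandwich condition -/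

/-- Under the law `μ`, the parameters with number `< t` are independent of those with number
`≥ t`. -/
def CutIndep {m : ℕ} (μ : Measure (Fin m → ℝ)) (t : ℕ) : Prop :=
  IndepFun (fun (θ : Fin m → ℝ) (i : {i : Fin m // i.val < t}) => θ i)
    (fun (θ : Fin m → ℝ) (i : {i : Fin m // t ≤ i.val}) => θ i) μ

/-- Two-design sandwich for one parameter: `U_θ = V₂ R_k(θ_k) V₁`, where the operators `V₁` and
`V₂` before and after the encoded gate are unitary two-designs, and the parameters in `V₁`, the
parameter `θ_k` and the parameters in `V₂` are independent. -/
def PauliCircuit.Sandwich₁ {n m : ℕ} (c : PauliCircuit n m) (μ : Measure (Fin m → ℝ))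
    (k : Fin m) : Prop :=
  CutIndep μ k.val ∧ CutIndep μ (k.val + 1) ∧
  IsTwoDesign μ (fun θ => c.segment θ 0 k.val) ∧
  IsTwoDesign μ (fun θ => c.segment θ (k.val + 1) (m - (k.val + 1)))

/-- Two-design sandwich for two parameters `k < l`: `U_θ = V₃ R_l(θ_l) V₂ R_k(θ_k) V₁`, where the
operators `V₁`, `V₂` and `V₃` are unitary two-designs, and the parameters in `V₁`, `θ_k`, the
parameters in `V₂`, `θ_l` and the parameters in `V₃` are independent. -/
def PauliCircuit.Sandwich₂ {n m : ℕ} (c : PauliCircuit n m) (μ : Measure (Fin m → ℝ))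
    (k l : Fin m) : Prop :=
  CutIndep μ k.val ∧ CutIndep μ (k.val + 1) ∧ CutIndep μ l.val ∧ CutIndep μ (l.val + 1) ∧
  IsTwoDesign μ (fun θ => c.segment θ 0 k.val) ∧
  IsTwoDesign μ (fun θ => c.segment θ (k.val + 1) (l.val - (k.val + 1))) ∧
  IsTwoDesign μ (fun θ => c.segment θ (l.val + 1) (m - (l.val + 1)))

/-- The two-design-sandwich (TDS) condition for the parameters of a component: each encoded gate
is sandwiched by two-design circuit operators. -/
def PauliCircuit.TDS {n m : ℕ} (c : PauliCircuit n m) (μ : Measure (Fin m → ℝ)) :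
    Component m → Prop
  | .gradient k => c.Sandwich₁ μ k
  | .diagHessian k => c.Sandwich₁ μ k
  | .offDiagHessian k l _ => c.Sandwich₂ μ (min k l) (max k l)

/-! ### Noise -/

/-- `σ` is a density operator. -/
def IsDensity {n : ℕ} (σ : Op n) : Prop := σ.PosSemidef ∧ σ.trace = 1

/-- The noisy output states `ρ θ` have error rate `η` and the parameter-independent error term
`ρerr`. -/
def PauliCircuit.HasConstantErrorTerm {n m : ℕ} (c : PauliCircuit n m) (η : ℝ) (ρerr : Op n)
    (ρ : (Fin m → ℝ) → Op n) : Prop :=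
  IsDensity ρerr ∧ ∀ θ, ρ θ = ((1 - η : ℝ) : ℂ) • c.state θ + (η : ℂ) • ρerr

/-! ### Sampling -/

/-- The columns of the unitary `B` are eigenkets of `O`, with the real eigenvalues `o`. -/
def IsEigenbasis {n : ℕ} (O : Op n) (B : Matrix.unitaryGroup (Qubits n) ℂ)
    (o : Qubits n → ℝ) : Prop :=
  O * (B : Op n) = (B : Op n) * Matrix.diagonal (fun k => (o k : ℂ))

/-- Born probability `⟨k| ρ |k⟩` of the outcome `k` of a measurement of the state `ρ` in the
basis of the columns of `B`. -/
noncomputable def bornProb {n : ℕ} (B : Matrix.unitaryGroup (Qubits n) ℂ) (ρ : Op n)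
    (k : Qubits n) : ℝ :=
  (((B : Op n)ᴴ * ρ * (B : Op n)) k k).re

/-- The estimator `(1 / N) ∑_k o_k n_k` of a function value from the outcomes of `N` copies. -/
noncomputable def sampleMean {n N : ℕ} (o : Qubits n → ℝ) (x : Fin N → Qubits n) : ℝ :=
  (∑ j, o (x j)) / N

/-- Mean-squared error, averaged over the parameters and over the measurement data, of the scaled
parameter-shift estimator `lam * ∑ a, weight a * (estimate of f (θ + shift a))` of the component
`comp` of the noiseless circuit function. The output states that are measured are `ρ θ`. Every
one of the sampled function values is estimated from `N` copies, with independent data, so that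
`stencil.size * N` copies are used in total. The value `lam = 1` is the parameter-shift scheme. -/
noncomputable def mse {n m : ℕ} (c : PauliCircuit n m) (μ : Measure (Fin m → ℝ)) (O : Op n)
    (B : Matrix.unitaryGroup (Qubits n) ℂ) (o : Qubits n → ℝ) (ρ : (Fin m → ℝ) → Op n)
    (comp : Component m) (N : ℕ) (lam : ℝ) : ℝ :=
  ∫ θ, ∑ x : Fin comp.stencil.size → Fin N → Qubits n,
    (∏ a, ∏ j, bornProb B (ρ (θ + comp.stencil.shift a)) (x a j)) *
      (lam * ∑ a, comp.stencil.weight a * sampleMean o (x a)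
        - comp.trueValue (c.value O) θ) ^ 2 ∂μ

/-! ### Noiselessly optimal scaling and the critical copy number -/

/-- The scaling `λ_opt` for noiseless circuits, as a function of `d = 2 ^ n` and of the total
number `NT` of copies. -/
noncomputable def lamOpt (d NT : ℝ) : Kind → ℝ
  | .gradient => d * NT / (2 * d ^ 2 + d * NT - 2)
  | .diagHessian => 4 * d * NT / (9 * d ^ 2 + 4 * d * NT - 9)
  | .offDiagHessian => d ^ 3 * NT / (4 * (d ^ 2 - 1) ^ 2 + d ^ 3 * NT)

/-- The function `h(d, η)` for a vanishing error term `g = 0`. -/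
noncomputable def hZero (d η : ℝ) : ℝ :=
  d + 4 * η + η ^ 2 * (d - 2) +
    Real.sqrt (4 * η ^ 2 * (2 - η) ^ 2 + 4 * d * η * (2 + η * (1 - η) * (3 - η)) +
      d ^ 2 * (1 + η * (8 - 6 * η + η ^ 3)))

/-- The function `h` for an arbitrary value of the error term `g`. Here
`d + 2η - η² - (d+1)η²g²` is `d + 1` times the mean variance of one measurement outcome. -/
noncomputable def hGen (d η g : ℝ) : ℝ :=
  let q := d + 2 * η - η ^ 2 - (d + 1) * η ^ 2 * g ^ 2
  let b := 2 * q - d * (1 - η ^ 2)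
  b + Real.sqrt (b ^ 2 + 8 * d * η * (1 - η) * q)

/-- The critical copy number, in terms of a value `h` of the functions above. -/
noncomputable def criticalOf (d η h : ℝ) : Kind → ℝ
  | .gradient => (d ^ 2 - 1) * h / (2 * d ^ 2 * η * (1 - η))
  | .diagHessian => 9 * (d ^ 2 - 1) * h / (16 * d ^ 2 * η * (1 - η))
  | .offDiagHessian => (d ^ 2 - 1) ^ 2 * h / (d ^ 4 * η * (1 - η))

/-- The critical copy number `N_*` for `d = 2 ^ n`, error rate `0 < η < 1` and error term `g`. -/
noncomputable def critical (n : ℕ) (η g : ℝ) (κ : Kind) : ℝ :=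
  criticalOf (2 ^ n) η (hGen (2 ^ n) η g) κ

/-- The critical copy number to leading order in small `η`. -/
noncomputable def criticalLeading (n : ℕ) (η : ℝ) : Kind → ℝ
  | .gradient => (((2 : ℝ) ^ n) ^ 2 - 1) / (2 ^ n * η)
  | .diagHessian => 9 * (((2 : ℝ) ^ n) ^ 2 - 1) / (8 * 2 ^ n * η)
  | .offDiagHessian => 2 * (((2 : ℝ) ^ n) ^ 2 - 1) ^ 2 / ((2 ^ n) ^ 3 * η)

/-! ### The critical copy number as a real function -/

/-! Everything rests on one closed form of the MSE, `PauliCircuit.mse_eq`. A Pauli string has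
eigenvalues ±1, so an outcome with mean F = (1-η)f + ηg has variance 1 - F². The parameter-shift
rules are exact (`IsTrig.trueValue_eq`) and their weights w sum to zero, so ηg cancels and the
expected estimate is λ(1-η) times the true component D. Hence MSE = (λ²/N) Σ w² E(1-F²) +
(λ(1-η)-1)² E D², and only E f, E f² and E D² over θ are needed.

These come from second moments of two-designs. Left invariance of the Haar measure makes the moment
tensor unitarily invariant in its row indices, so it is a combination of the identity and the swap
pairing (`UnitaryInvariant.exists_eq`); testing on B = 1 fixes the coefficients. For the random pure
state ψ before the first encoded gate, E tr(ψB)² = (E (tr B)² + E tr B²)/(d(d+1)). This gives E f² =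
1/(d+1), E f = 0, and E D² = E tr X²/(d(d+1)), where X is the traceless Heisenberg observable of the
component. Up to conjugation X is a commutator of the Pauli generator P with an observable A (times
P for the diagonal Hessian), so tr X² = (tr A² - tr PAPA)/2. The two-design after the gate averages
tr PAPA to -tr A²/(d²-1) (`IsTwoDesign.integral_trace_otoc`). Each encoded gate thus contributes a
factor d²/(2(d²-1)).

With p = `criticalPrefactor` and y = N_T/(4dp), all three kinds take the form M(λ² q/(dy) +
(λ(1-η)-1)²), where M = E D². Without noise q = d and the minimizer is y/(1+y). The PS error minus
the NSPS error is a positive multiple of q + by - 2dη(1-η)y². For 0 < η < 1 its only positive root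
is h/(4dη(1-η)), so N_* = p h/(η(1-η)). The asymptotics follow from 2b ≤ h ≤ 2b + 4dη(1-η)q/b. -/

theorem two_le_two_pow {n : ℕ} (hn : 1 ≤ n) : (2 : ℝ) ≤ 2 ^ n := by
  simpa using pow_le_pow_right₀ (by norm_num : (1 : ℝ) ≤ 2) hn

/-- `d + 1` times the mean variance of one measurement outcome. -/
noncomputable def varianceFactor (d η g : ℝ) : ℝ := d + 2 * η - η ^ 2 - (d + 1) * η ^ 2 * g ^ 2

/-- The linear coefficient of the quadratic equation of which `hGen` is a root. -/
noncomputable def linearFactor (d η g : ℝ) : ℝ := 2 * varianceFactor d η g - d * (1 - η ^ 2)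

theorem hGen_eq (d η g : ℝ) : hGen d η g = linearFactor d η g +
    Real.sqrt (linearFactor d η g ^ 2 + 8 * d * η * (1 - η) * varianceFactor d η g) := rfl

/-- The worst case is |g| = 1, where equality holds. This bound keeps q, and with it b, positive for
η < 1. -/
theorem le_varianceFactor {d η g : ℝ} (hd : 0 ≤ d) (hg : |g| ≤ 1) :
    d * (1 - η ^ 2) + 2 * η * (1 - η) ≤ varianceFactor d η g := by
  have h1 : g ^ 2 ≤ 1 := by rwa [sq_le_one_iff_abs_le_one]
  have : 0 ≤ (d + 1) * η ^ 2 * (1 - g ^ 2) := by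
    have : 0 ≤ 1 - g ^ 2 := by linarith
    positivity
  unfold varianceFactor
  nlinarith

theorem varianceFactor_pos {d η g : ℝ} (hd : 0 < d) (hg : |g| ≤ 1) (h0 : 0 ≤ η) (h1 : η < 1) :
    0 < varianceFactor d η g := by
  have h := le_varianceFactor (η := η) hd.le hg
  have : 0 < d * (1 - η ^ 2) := mul_pos hd (by nlinarith)
  have : 0 ≤ 2 * η * (1 - η) := mul_nonneg (by linarith) (by linarith)
  linarith

theorem varianceFactor_le {d η g : ℝ} (hd : 0 ≤ d) : varianceFactor d η g ≤ d + 2 * η := by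
  have : 0 ≤ (d + 1) * η ^ 2 * g ^ 2 := by positivity
  unfold varianceFactor
  nlinarith [sq_nonneg η]

theorem le_linearFactor {d η g : ℝ} (hd : 0 ≤ d) (hg : |g| ≤ 1) (h0 : 0 ≤ η) (h1 : η ≤ 1) :
    d * (1 - η ^ 2) ≤ linearFactor d η g := by
  have h := le_varianceFactor (η := η) hd hg
  have : 0 ≤ 2 * η * (1 - η) := mul_nonneg (by linarith) (by linarith)
  unfold linearFactor
  linarith

theorem hGen_lower {d η g : ℝ} (hd : 0 < d) (hg : |g| ≤ 1) (h0 : 0 ≤ η) (h1 : η < 1) :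
    2 * linearFactor d η g ≤ hGen d η g := by
  have hq := varianceFactor_pos hd hg h0 h1
  have : linearFactor d η g ≤
      Real.sqrt (linearFactor d η g ^ 2 + 8 * d * η * (1 - η) * varianceFactor d η g) := by
    apply Real.le_sqrt_of_sq_le
    have : 0 ≤ 8 * d * η * (1 - η) * varianceFactor d η g := by
      have : 0 ≤ 1 - η := by linarith
      positivity
    linarith
  rw [hGen_eq]
  linarith

/-- The tangent bound `√(b² + e) ≤ b + e / (2b)`. -/
theorem hGen_upper {d η g : ℝ} (hd : 0 < d) (hg : |g| ≤ 1) (h0 : 0 ≤ η) (h1 : η < 1) :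
    hGen d η g ≤ 2 * linearFactor d η g +
      4 * d * η * (1 - η) * varianceFactor d η g / linearFactor d η g := by
  have hq := varianceFactor_pos hd hg h0 h1
  have hb : 0 < linearFactor d η g :=
    (mul_pos hd (by nlinarith)).trans_le (le_linearFactor hd.le hg h0 h1.le)
  have h1' : 0 ≤ 1 - η := by linarith
  set b := linearFactor d η g
  set q := varianceFactor d η g
  have : Real.sqrt (b ^ 2 + 8 * d * η * (1 - η) * q) ≤ b + 4 * d * η * (1 - η) * q / b := by
    apply Real.sqrt_le_iff.mpr ⟨by positivity, ?_⟩
    have : (b + 4 * d * η * (1 - η) * q / b) ^ 2 =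
        b ^ 2 + 8 * d * η * (1 - η) * q + (4 * d * η * (1 - η) * q / b) ^ 2 := by
      field_simp
      ring
    rw [this]
    nlinarith [sq_nonneg (4 * d * η * (1 - η) * q / b)]
  rw [hGen_eq]
  linarith

/-- `hGen` is the larger root of x² - 2bx - 8dη(1-η)q; in this form the square root is no longer
needed. -/
theorem hGen_root {d η g : ℝ} (hd : 0 < d) (hg : |g| ≤ 1) (h0 : 0 < η) (h1 : η < 1) :
    hGen d η g ^ 2 = 2 * linearFactor d η g * hGen d η g +
      8 * d * η * (1 - η) * varianceFactor d η g := by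
  have hq := varianceFactor_pos hd hg h0.le h1
  have h1' : 0 ≤ 1 - η := by linarith
  rw [hGen_eq]
  have := Real.sq_sqrt (x := linearFactor d η g ^ 2 +
    8 * d * η * (1 - η) * varianceFactor d η g) (by positivity)
  linear_combination this

theorem hGen_pos {d η g : ℝ} (hd : 0 < d) (hg : |g| ≤ 1) (h0 : 0 ≤ η) (h1 : η < 1) :
    0 < hGen d η g := by
  have hb : 0 < linearFactor d η g :=
    (mul_pos hd (by nlinarith)).trans_le (le_linearFactor hd.le hg h0 h1.le)
  linarith [hGen_lower hd hg h0 h1]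

/-- The critical copy number divided by `h / (η (1 - η))`. -/
noncomputable def criticalPrefactor (d : ℝ) : Kind → ℝ
  | .gradient => (d ^ 2 - 1) / (2 * d ^ 2)
  | .diagHessian => 9 * (d ^ 2 - 1) / (16 * d ^ 2)
  | .offDiagHessian => (d ^ 2 - 1) ^ 2 / d ^ 4

theorem criticalOf_eq (d η h : ℝ) (κ : Kind) :
    criticalOf d η h κ = criticalPrefactor d κ * (h / (η * (1 - η))) := by
  cases κ <;> simp only [criticalOf, criticalPrefactor, div_mul_div_comm, mul_assoc]

/-- The value 3/8 is that of the gradient at d = 2; the bound 1 is the limit of the off-diagonal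
case for large d. -/
theorem criticalPrefactor_mem {d : ℝ} (hd : 2 ≤ d) (κ : Kind) :
    3 / 8 ≤ criticalPrefactor d κ ∧ criticalPrefactor d κ ≤ 1 := by
  have h2 : 4 ≤ d ^ 2 := by nlinarith
  have hd0 : 0 < d := by linarith
  cases κ <;> simp only [criticalPrefactor] <;> constructor <;>
    first
    | rw [div_le_div_iff₀ (by positivity) (by positivity)]; nlinarith [sq_nonneg (d ^ 2 - 4)]
    | rw [div_le_one (by positivity)]; nlinarith

theorem criticalLeading_eq (n : ℕ) (η : ℝ) (κ : Kind) :
    criticalLeading n η κ = criticalPrefactor (2 ^ n) κ * (2 * 2 ^ n / η) := by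
  have : (2 : ℝ) ^ n ≠ 0 := by positivity
  cases κ <;> simp only [criticalLeading, criticalPrefactor]
  · field_simp
  · rw [div_mul_div_comm]
    by_cases h : η = 0
    · simp [h]
    field_simp
    ring
  · field_simp

theorem critical_eq_of_vanishing_error (n : ℕ) (η : ℝ) (κ : Kind) :
    critical n η 0 κ = criticalOf (2 ^ n) η (hZero (2 ^ n) η) κ := by
  unfold critical
  congr 1
  unfold hGen hZero
  dsimp only
  congr 1
  · ring
  · congr 1
    ring

/-- Over the common denominator η(1-η) the leading term has numerator 2d(1-η), so it suffices that h
= 2d(1-η) + O(dη). This follows from 2b ≤ h ≤ 2b + O(dη) and b = d + O(dη). The constant 50 for the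
numerator becomes 100 because 1-η ≥ 1/2. -/
theorem abs_critical_sub_leading_le (n : ℕ) (η g : ℝ) (κ : Kind) (hn : 1 ≤ n) (h0 : 0 < η)
    (h1 : η ≤ 1 / 2) (hg : |g| ≤ 1) :
    |critical n η g κ - criticalLeading n η κ| ≤ 100 * 2 ^ n := by
  have hd := two_le_two_pow hn
  rw [critical, criticalOf_eq, criticalLeading_eq]
  generalize (2 : ℝ) ^ n = d at hd ⊢
  have hd0 : 0 < d := by linarith
  obtain ⟨hp0, hp1⟩ := criticalPrefactor_mem hd κ
  have hη : 0 < 1 - η := by linarith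
  have e : criticalPrefactor d κ * (hGen d η g / (η * (1 - η))) -
      criticalPrefactor d κ * (2 * d / η) =
      criticalPrefactor d κ * ((hGen d η g - 2 * d * (1 - η)) / (η * (1 - η))) := by
    field_simp
  rw [e, abs_mul, abs_of_nonneg (by linarith : 0 ≤ criticalPrefactor d κ)]
  suffices h : |(hGen d η g - 2 * d * (1 - η)) / (η * (1 - η))| ≤ 100 * d by
    calc _ ≤ 1 * (100 * d) := mul_le_mul hp1 h (abs_nonneg _) zero_le_one
      _ = _ := one_mul _
  rw [abs_div, abs_of_pos (mul_pos h0 hη), div_le_iff₀ (mul_pos h0 hη)]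
  have hl := hGen_lower hd0 hg h0.le (by linarith : η < 1)
  have hu := hGen_upper hd0 hg h0.le (by linarith : η < 1)
  have hq := le_varianceFactor (η := η) hd0.le hg
  have hq' := varianceFactor_le (η := η) (g := g) hd0.le
  have hb := le_linearFactor hd0.le hg h0.le (by linarith : η ≤ 1)
  have hη2 : η ^ 2 ≤ 1 / 4 := by nlinarith
  have hbd : d / 2 ≤ linearFactor d η g := by nlinarith
  have hbd' : linearFactor d η g ≤ d + 5 * d * η := by
    unfold linearFactor; nlinarith [mul_pos hd0 h0]
  have hr : 4 * d * η * (1 - η) * varianceFactor d η g / linearFactor d η g ≤ 16 * (d * η) := by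
    rw [div_le_iff₀ (by linarith)]
    have hv : varianceFactor d η g ≤ 2 * d := by nlinarith
    calc 4 * d * η * (1 - η) * varianceFactor d η g ≤ 4 * d * η * 1 * (2 * d) := by
          gcongr
          · have := varianceFactor_pos hd0 hg h0.le (by linarith : η < 1)
            linarith
          · linarith
      _ = 16 * (d * η) * (d / 2) := by ring
      _ ≤ _ := by gcongr
  have hdη : 0 < d * η := mul_pos hd0 h0
  have hd2 : d * η ^ 2 ≤ d * η := by nlinarith
  have key : |hGen d η g - 2 * d * (1 - η)| ≤ 50 * (d * η) := by
    rw [abs_le]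
    constructor <;> nlinarith
  calc _ ≤ 50 * (d * η) := key
    _ ≤ _ := by nlinarith

/-- From below, h ≥ 2b ≥ 2d(1-η²) absorbs the factor 1-η of the denominator. From above, q ≤ 2d and
b ≤ 4d bound h by a multiple of d uniformly in η, and the factor 1-η stays. -/
theorem critical_growth (n : ℕ) (η g : ℝ) (κ : Kind) (hn : 1 ≤ n) (h0 : 0 < η) (h1 : η < 1)
    (hg : |g| ≤ 1) :
    3 / 8 * (2 ^ n / η) ≤ critical n η g κ ∧ critical n η g κ ≤ 100 * (2 ^ n / (η * (1 - η))) := by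
  have hd := two_le_two_pow hn
  rw [critical, criticalOf_eq]
  generalize (2 : ℝ) ^ n = d at hd ⊢
  have hd0 : 0 < d := by linarith
  obtain ⟨hp0, hp1⟩ := criticalPrefactor_mem hd κ
  have hη : 0 < 1 - η := by linarith
  have hl := hGen_lower hd0 hg h0.le h1
  have hq := varianceFactor_pos hd0 hg h0.le h1
  have hq' := varianceFactor_le (η := η) (g := g) hd0.le
  have hb := le_linearFactor hd0.le hg h0.le h1.le
  constructor
  · have : d / η ≤ hGen d η g / (η * (1 - η)) := by
      rw [div_le_div_iff₀ h0 (by positivity)]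
      have : d * (1 - η) ≤ hGen d η g := by nlinarith [mul_pos hd0 hη, mul_pos hd0 h0]
      nlinarith
    exact mul_le_mul hp0 this (by positivity) (by linarith)
  · have hv : varianceFactor d η g ≤ 2 * d := by nlinarith
    have hb' : linearFactor d η g ≤ 4 * d := by
      unfold linearFactor
      nlinarith [mul_pos hd0 hη, mul_pos hd0 h0]
    have hb0 : 0 ≤ linearFactor d η g := le_trans (by nlinarith [mul_pos hd0 hη]) hb
    have : hGen d η g ≤ 100 * d := by
      rw [hGen_eq]
      have : Real.sqrt (linearFactor d η g ^ 2 + 8 * d * η * (1 - η) * varianceFactor d η g) ≤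
          10 * d := by
        apply Real.sqrt_le_iff.mpr ⟨by positivity, ?_⟩
        have e1 : linearFactor d η g ^ 2 ≤ (4 * d) ^ 2 := by gcongr
        have e2 : 8 * d * η * (1 - η) * varianceFactor d η g ≤ 8 * d * 1 * 1 * (2 * d) := by
          gcongr
          linarith
        nlinarith
      linarith
    have h3 : hGen d η g / (η * (1 - η)) ≤ 100 * (d / (η * (1 - η))) := by
      rw [← mul_div_assoc]
      gcongr
    calc _ ≤ 1 * (100 * (d / (η * (1 - η)))) := by
          refine mul_le_mul hp1 h3 ?_ zero_le_one
          have := hGen_pos hd0 hg h0.le h1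
          positivity
      _ = _ := one_mul _

/-! ### Comparison of the schemes for a quadratic mean-squared error -/

/-- The mean-squared error as a function of the scaling `lam`; `M` is the mean square of the
component and `y` is proportional to the number of copies. -/
noncomputable def quadraticError (d η g M y lam : ℝ) : ℝ :=
  M * (lam ^ 2 * (varianceFactor d η g / (d * y)) + (lam * (1 - η) - 1) ^ 2)

/-- The three formulas for the scaling become the single expression y/(1+y) with y = N_T/(4dp),
which lets the kinds be treated together. -/
theorem lamOpt_eq {d : ℝ} (hd : 2 ≤ d) {NT : ℝ} (hN : 0 < NT) (κ : Kind) :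
    lamOpt d NT κ = NT / (4 * d * criticalPrefactor d κ) /
      (1 + NT / (4 * d * criticalPrefactor d κ)) := by
  have h1 : 0 < d ^ 2 - 1 := by nlinarith
  have h2 : 0 < d := by linarith
  have h3 : 0 < d * NT := mul_pos h2 hN
  have h4 : 0 < d ^ 3 * NT := by positivity
  cases κ <;> simp only [lamOpt, criticalPrefactor]
  · rw [div_eq_div_iff (by linarith) (by positivity)]
    field_simp
    ring
  · rw [div_eq_div_iff (by linarith) (by positivity)]
    field_simp
    ring
  · rw [div_eq_div_iff (by positivity) (by positivity)]
    field_simp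

/-- Complete the square: for η = 0 one has q = d, and the error is a parabola in λ with vertex
y/(1+y). -/
theorem quadraticError_noiseless_lt {d M y lam : ℝ} (hd : 0 < d) (hM : 0 < M) (hy : 0 < y) (g : ℝ)
    (h : lam ≠ y / (1 + y)) :
    quadraticError d 0 g M y (y / (1 + y)) < quadraticError d 0 g M y lam := by
  have e : quadraticError d 0 g M y lam - quadraticError d 0 g M y (y / (1 + y)) =
      M * (1 + y) / y * (lam - y / (1 + y)) ^ 2 := by
    unfold quadraticError varianceFactor
    field_simp
    ring
  have h2 : 0 < (lam - y / (1 + y)) ^ 2 := by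
    have := sub_ne_zero.mpr h
    positivity
  have : 0 < M * (1 + y) / y * (lam - y / (1 + y)) ^ 2 := by positivity
  linarith

/-- At λ = y/(1+y) the bias factor λ(1-η)-1 equals -(1+ηy)/(1+y); over the denominator dy(1+y)² only
a quadratic polynomial in y remains. -/
theorem quadraticError_sub {d M y : ℝ} (η g : ℝ) (hd : 0 < d) (hy : 0 < y) :
    quadraticError d η g M y 1 - quadraticError d η g M y (y / (1 + y)) =
      M / (d * y * (1 + y) ^ 2) * (varianceFactor d η g + linearFactor d η g * y -
        2 * d * η * (1 - η) * y ^ 2) := by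
  unfold quadraticError linearFactor
  field_simp
  ring

/-- The sign of the quadratic polynomial that compares the schemes. -/
theorem comparison_factor {d η g y : ℝ} (hd : 0 < d) (hg : |g| ≤ 1) (h0 : 0 < η) (h1 : η < 1)
    (hy : 0 < y) :
    ∃ r > 0, varianceFactor d η g + linearFactor d η g * y - 2 * d * η * (1 - η) * y ^ 2 =
      r * (hGen d η g / (4 * d * η * (1 - η)) - y) := by
  have hη : 0 < 1 - η := by linarith
  have hq := varianceFactor_pos hd hg h0.le h1
  have hh := hGen_pos hd hg h0.le h1
  have hroot := hGen_root hd hg h0 h1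
  -- The roots in y have product -q/(2dη(1-η)); one is h/(4dη(1-η)), so the other is -2q/h. The
  -- witness is 2dη(1-η)(y + 2q/h), positive for y > 0.
  refine ⟨2 * d * η * (1 - η) * y + 4 * d * η * (1 - η) * varianceFactor d η g / hGen d η g,
    by positivity, ?_⟩
  generalize hGen d η g = h at *
  generalize varianceFactor d η g = q at *
  generalize linearFactor d η g = b at *
  -- Solving the quadratic equation of h for b turns the identity into one between rational
  -- functions.
  have hb : b = (h ^ 2 - 8 * d * η * (1 - η) * q) / (2 * h) := by
    field_simp
    linarith
  rw [hb]
  field_simp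
  ring

/-- The difference of the two errors is a positive multiple of N_* - N_T, so its sign and its zero
are read off together. -/
theorem quadraticError_compare {d η g M NT p : ℝ} (hd : 0 < d) (hM : 0 < M) (hN : 0 < NT)
    (hp : 0 < p) (hg : |g| ≤ 1) (h0 : 0 < η) (h1 : η < 1) :
    (quadraticError d η g M (NT / (4 * d * p)) (NT / (4 * d * p) / (1 + NT / (4 * d * p))) <
        quadraticError d η g M (NT / (4 * d * p)) 1 ↔ NT < p * (hGen d η g / (η * (1 - η)))) ∧
    (quadraticError d η g M (NT / (4 * d * p)) (NT / (4 * d * p) / (1 + NT / (4 * d * p))) =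
        quadraticError d η g M (NT / (4 * d * p)) 1 ↔ NT = p * (hGen d η g / (η * (1 - η)))) := by
  have hη : 0 < 1 - η := by linarith
  have hy : 0 < NT / (4 * d * p) := by positivity
  obtain ⟨r, hr, e⟩ := comparison_factor hd hg h0 h1 hy
  have hs := quadraticError_sub (M := M) η g hd hy
  rw [e] at hs
  have e2 : hGen d η g / (4 * d * η * (1 - η)) - NT / (4 * d * p) =
      (p * (hGen d η g / (η * (1 - η))) - NT) / (4 * d * p) := by
    field_simp
  rw [e2] at hs
  set y := NT / (4 * d * p)
  have hc : 0 < M / (d * y * (1 + y) ^ 2) * (r / (4 * d * p)) := by positivity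
  have hs' : quadraticError d η g M y 1 - quadraticError d η g M y (y / (1 + y)) =
      M / (d * y * (1 + y) ^ 2) * (r / (4 * d * p)) *
        (p * (hGen d η g / (η * (1 - η))) - NT) := by rw [hs]; ring
  generalize M / (d * y * (1 + y) ^ 2) * (r / (4 * d * p)) = s at hc hs'
  constructor
  · rw [← sub_pos, hs', mul_pos_iff_of_pos_left hc, sub_pos]
  · rw [eq_comm, ← sub_eq_zero, hs', mul_eq_zero, or_iff_right hc.ne', sub_eq_zero, eq_comm]

/-- At η = 0 and η = 1 the y² term vanishes. What is left is d(1+y) for η = 0 and (d+1)(1-g²)(1+2y)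
for η = 1. -/
theorem quadraticError_lt_of_extreme {d η g M y : ℝ} (hd : 0 < d) (hM : 0 < M) (hy : 0 < y)
    (h : η = 0 ∨ (η = 1 ∧ |g| < 1)) :
    quadraticError d η g M y (y / (1 + y)) < quadraticError d η g M y 1 := by
  have hs := quadraticError_sub (M := M) η g hd hy
  have : 0 < varianceFactor d η g + linearFactor d η g * y - 2 * d * η * (1 - η) * y ^ 2 := by
    rcases h with rfl | ⟨rfl, hg⟩
    · unfold linearFactor varianceFactor
      nlinarith [mul_pos hd hy]
    · have h2 : g ^ 2 < 1 := (sq_lt_one_iff_abs_lt_one g).mpr hg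
      have : 0 < (d + 1) * (1 - g ^ 2) := mul_pos (by linarith) (by linarith)
      unfold linearFactor varianceFactor
      nlinarith [mul_pos this hy]
  have : 0 < M / (d * y * (1 + y) ^ 2) * (varianceFactor d η g + linearFactor d η g * y -
      2 * d * η * (1 - η) * y ^ 2) := by positivity
  linarith

/-! ### Tensors that are invariant under the unitary group -/

section Twirl

variable {ι : Type*} [DecidableEq ι]

/-- The four-index tensor `T` is invariant under the action `W ⊗ W* ⊗ W ⊗ W*` of the unitary
group. -/
def UnitaryInvariant [Fintype ι] (T : ι → ι → ι → ι → ℂ) : Prop :=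
  ∀ W ∈ Matrix.unitaryGroup ι ℂ, ∀ i j k l,
    T i j k l = ∑ a, ∑ b, ∑ c, ∑ e, W i a * star (W j b) * (W k c * star (W l e)) * T a b c e

theorem diagonal_mem_unitaryGroup [Fintype ι] {w : ι → ℂ} (hw : ∀ i, w i * star (w i) = 1) :
    Matrix.diagonal w ∈ Matrix.unitaryGroup ι ℂ := by
  rw [Matrix.mem_unitaryGroup_iff, Matrix.star_eq_conjTranspose, Matrix.diagonal_conjTranspose,
    Matrix.diagonal_mul_diagonal]
  simp only [Pi.star_apply, hw, Matrix.diagonal_one]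

theorem UnitaryInvariant.phase [Fintype ι] {T : ι → ι → ι → ι → ℂ} (hT : UnitaryInvariant T) {w : ι → ℂ}
    (hw : ∀ i, w i * star (w i) = 1) (i j k l : ι) :
    T i j k l = w i * star (w j) * (w k * star (w l)) * T i j k l := by
  conv_lhs => rw [hT _ (diagonal_mem_unitaryGroup hw)]
  simp [Matrix.diagonal_apply, apply_ite star]

/-- The permutation matrix of `σ`. -/
def permMat (σ : Equiv.Perm ι) : Matrix ι ι ℂ := Matrix.of fun i j => if σ i = j then 1 else 0

theorem permMat_mul [Fintype ι] (σ τ : Equiv.Perm ι) : permMat σ * permMat τ = permMat (σ.trans τ) := by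
  ext i j
  simp only [permMat, Matrix.mul_apply, Matrix.of_apply, ite_mul, one_mul, zero_mul,
    Finset.sum_ite_eq, Finset.mem_univ, if_true, Equiv.trans_apply]
  rfl

theorem permMat_refl : permMat (Equiv.refl ι) = 1 := by
  ext i j
  simp only [permMat, Matrix.one_apply, Matrix.of_apply, Equiv.refl_apply]
  rfl

theorem permMat_conjTranspose (σ : Equiv.Perm ι) : (permMat σ)ᴴ = permMat σ.symm := by
  ext i j
  simp only [permMat, Matrix.conjTranspose_apply, Matrix.of_apply, Equiv.symm_apply_eq]
  by_cases h : σ j = i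
  · simp [h]
  · simp [h, Ne.symm h]

theorem permMat_mem_unitaryGroup [Fintype ι] (σ : Equiv.Perm ι) : permMat σ ∈ Matrix.unitaryGroup ι ℂ := by
  rw [Matrix.mem_unitaryGroup_iff, Matrix.star_eq_conjTranspose, permMat_conjTranspose,
    permMat_mul, Equiv.self_trans_symm, permMat_refl]

theorem UnitaryInvariant.perm [Fintype ι] {T : ι → ι → ι → ι → ℂ} (hT : UnitaryInvariant T)
    (σ : Equiv.Perm ι) (i j k l : ι) : T i j k l = T (σ i) (σ j) (σ k) (σ l) := by
  conv_lhs => rw [hT _ (permMat_mem_unitaryGroup σ)]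
  simp [permMat, apply_ite star]

/-- The unitary `(1 + i S) / √2` where `S` exchanges two basis vectors. -/
noncomputable def swapRotation (a b : ι) : Matrix ι ι ℂ :=
  ((Real.sqrt 2)⁻¹ : ℂ) • (1 + Complex.I • permMat (Equiv.swap a b))

theorem inv_sqrt_two_mul_self : ((Real.sqrt 2)⁻¹ : ℂ) * ((Real.sqrt 2)⁻¹ : ℂ) = 1 / 2 := by
  rw [← mul_inv, ← Complex.ofReal_mul, Real.mul_self_sqrt (by norm_num)]
  simp

theorem swapRotation_mem_unitaryGroup [Fintype ι] (a b : ι) :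
    swapRotation a b ∈ Matrix.unitaryGroup ι ℂ := by
  rw [Matrix.mem_unitaryGroup_iff, Matrix.star_eq_conjTranspose]
  have h : (swapRotation a b)ᴴ =
      ((Real.sqrt 2)⁻¹ : ℂ) • (1 - Complex.I • permMat (Equiv.swap a b)) := by
    simp [swapRotation, Matrix.conjTranspose_smul, permMat_conjTranspose, sub_eq_add_neg]
  have hS : permMat (Equiv.swap a b) * permMat (Equiv.swap a b) = (1 : Matrix ι ι ℂ) := by
    rw [permMat_mul, ← permMat_refl]
    congr 1
    ext i
    simp
  rw [h, swapRotation, smul_mul_smul_comm, inv_sqrt_two_mul_self]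
  simp only [add_mul, mul_sub, one_mul, mul_one, smul_mul_smul_comm, hS, Complex.I_mul_I]
  ext i j
  simp
  ring

theorem swapRotation_row (a b c : ι) :
    swapRotation a b a c = ((Real.sqrt 2)⁻¹ : ℂ) *
      ((if a = c then 1 else 0) + if b = c then Complex.I else 0) := by
  simp [swapRotation, permMat, Matrix.one_apply]

/-- The hypotheses say that {i, k} and {j, l} differ as multisets. A phase i on one basis vector
multiplies the entry by a power of i whose exponent is the number of occurrences of that vector in
the first multiset minus that in the second; a suitable vector gives a factor other than 1. -/
theorem UnitaryInvariant.eq_zero [Fintype ι] {T : ι → ι → ι → ι → ℂ} (hT : UnitaryInvariant T)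
    {i j k l : ι} (h1 : ¬(i = j ∧ k = l)) (h2 : ¬(i = l ∧ k = j)) : T i j k l = 0 := by
  have key : ∀ (a : ι), (Function.update (fun _ => (1 : ℂ)) a Complex.I i *
      star (Function.update (fun _ => (1 : ℂ)) a Complex.I j) *
      (Function.update (fun _ => (1 : ℂ)) a Complex.I k *
      star (Function.update (fun _ => (1 : ℂ)) a Complex.I l))) ≠ 1 → T i j k l = 0 := by
    intro a ha
    have hp := hT.phase (w := Function.update (fun _ => (1 : ℂ)) a Complex.I) (fun x => by
      by_cases hx : x = a <;> simp [hx]) i j k l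
    by_contra h0
    exact ha (mul_right_cancel₀ h0 (by rw [one_mul]; exact hp.symm))
  have hI : Complex.I ≠ 1 := fun h => by simpa using congrArg Complex.re h
  have hI' : -Complex.I ≠ 1 := fun h => by simpa using congrArg Complex.re h
  have hm : (-1 : ℂ) ≠ 1 := by norm_num
  by_cases e1 : i = j
  · subst e1
    have hkl : k ≠ l := fun h => h1 ⟨rfl, h⟩
    apply key k
    by_cases hik : i = k
    · subst hik; simp [hkl.symm, hI]
    · simp [hik, hkl.symm, hI]
  · by_cases e2 : i = l
    · subst e2
      have hkj : k ≠ j := fun h => h2 ⟨rfl, h⟩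
      apply key k
      by_cases hik : i = k
      · subst hik; simp [hkj.symm, hI]
      · simp [hik, hkj.symm, hI]
    · apply key i
      by_cases hik : k = i
      · subst hik; simp [Ne.symm e1, Ne.symm e2, hm]
      · simp [Ne.symm e1, Ne.symm e2, hik, hI]

theorem exists_perm_pair {a b i k : ι} (hab : a ≠ b) (hik : i ≠ k) :
    ∃ σ : Equiv.Perm ι, σ a = i ∧ σ b = k := by
  -- The first swap sends a to i; the second corrects the image of b and fixes i.
  refine ⟨(Equiv.swap a i).trans (Equiv.swap (Equiv.swap a i b) k), ?_, ?_⟩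
  · simp only [Equiv.trans_apply, Equiv.swap_apply_left]
    apply Equiv.swap_apply_of_ne_of_ne _ hik
    intro h
    apply hab
    apply (Equiv.swap a i).injective
    rw [Equiv.swap_apply_left]
    exact h
  · simp

/-- The invariant tensors are spanned by the identity and the swap. -/
theorem UnitaryInvariant.exists_eq [Fintype ι] [Nontrivial ι] {T : ι → ι → ι → ι → ℂ}
    (hT : UnitaryInvariant T) :
    ∃ α β : ℂ, ∀ i j k l, T i j k l =
      α * (if i = j ∧ k = l then 1 else 0) + β * (if i = l ∧ k = j then 1 else 0) := by
  obtain ⟨a, b, hab⟩ := exists_pair_ne ι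
  -- Phases and permutations alone would leave `T a a a a` as a third free parameter. Row a of
  -- (1+iS)/√2 is supported on a and b, and invariance under this matrix reads T_aaaa = (2 T_aaaa +
  -- 2 T_aabb + 2 T_abba)/4.
  have hγ : T a a a a = T a a b b + T a b b a := by
    have h := hT _ (swapRotation_mem_unitaryGroup a b) a a a a
    have hz := fun i j k l h1 h2 => hT.eq_zero (i := i) (j := j) (k := k) (l := l) h1 h2
    have hs1 : T b b a a = T a a b b := by
      have := hT.perm (Equiv.swap a b) a a b b
      simpa using this.symm
    have hs2 : T b a a b = T a b b a := by
      have := hT.perm (Equiv.swap a b) a b b a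
      simpa using this.symm
    have hs3 : T b b b b = T a a a a := by
      have := hT.perm (Equiv.swap a b) a a a a
      simpa using this.symm
    have hc : star ((Real.sqrt 2)⁻¹ : ℂ) = ((Real.sqrt 2)⁻¹ : ℂ) := by simp
    have h4 : ((Real.sqrt 2)⁻¹ : ℂ) ^ 4 = 1 / 4 := by
      rw [show ((Real.sqrt 2)⁻¹ : ℂ) ^ 4 = (((Real.sqrt 2)⁻¹ : ℂ) * ((Real.sqrt 2)⁻¹ : ℂ)) ^ 2 by
        ring, inv_sqrt_two_mul_self]
      norm_num
    simp only [swapRotation_row, star_mul', star_add, apply_ite star, star_zero, hc,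
      mul_add, add_mul, Finset.sum_add_distrib, mul_ite, ite_mul, mul_zero, zero_mul, mul_one,
      Finset.sum_ite_eq, Finset.mem_univ, if_true] at h
    -- Of the sixteen entries, these ten have unbalanced indices and vanish; exchanging a and b
    -- identifies the other six in pairs.
    rw [hz a a a b, hz a a b a, hz a b a a, hz b a a a, hz a b a b, hz b a b a, hz b b b a,
      hz b b a b, hz b a b b, hz a b b b, hs1, hs2, hs3] at h
    · have hI : star Complex.I = -Complex.I := by simp
      rw [hI] at h
      generalize ((Real.sqrt 2)⁻¹ : ℂ) = r at *
      have hI2 := Complex.I_mul_I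
      linear_combination 2 * h + 2 * (T a a a a * (1 + Complex.I ^ 4) -
        2 * Complex.I ^ 2 * (T a a b b + T a b b a)) * h4 +
        (T a a a a * (Complex.I ^ 2 - 1) / 2 - (T a a b b + T a b b a)) * hI2
    all_goals simp [hab, hab.symm]
  refine ⟨T a a b b, T a b b a, fun i j k l => ?_⟩
  by_cases h1 : i = j ∧ k = l
  · obtain ⟨rfl, rfl⟩ := h1
    by_cases hik : i = k
    · subst hik
      simp only [and_self, if_true, mul_one]
      rw [← hγ, hT.perm (Equiv.swap i a) i i i i]
      simp
    · obtain ⟨σ, h1, h2⟩ := exists_perm_pair hab hik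
      rw [hT.perm σ a a b b, h1, h2]
      simp [hik]
  · by_cases h2 : i = l ∧ k = j
    · obtain ⟨rfl, rfl⟩ := h2
      have hik : i ≠ k := fun h => h1 ⟨h, h.symm⟩
      obtain ⟨σ, h1, h2⟩ := exists_perm_pair hab hik
      rw [hT.perm σ a b b a, h1, h2]
      simp [hik]
    · rw [hT.eq_zero h1 h2]
      simp [h1, h2]

end Twirl

/-! ### Second moments of a two-design -/

section Sums

variable {ι : Type*} [Fintype ι]

theorem mul_sum_four (f g h k : ι → ℂ) :
    (∑ a, f a) * (∑ c, h c) * (∑ b, g b) * (∑ e, k e) =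
      ∑ a, ∑ b, ∑ c, ∑ e, f a * g b * (h c * k e) := by
  simp_rw [← Finset.mul_sum, ← Finset.sum_mul, ← Finset.mul_sum, ← Finset.sum_mul]
  ring

theorem integral_sum_four {Ω : Type*} [MeasurableSpace Ω] {μ : Measure Ω}
    {F : ι → ι → ι → ι → Ω → ℂ} (hF : ∀ a b c e, Integrable (F a b c e) μ) :
    ∫ ω, ∑ a, ∑ b, ∑ c, ∑ e, F a b c e ω ∂μ = ∑ a, ∑ b, ∑ c, ∑ e, ∫ ω, F a b c e ω ∂μ := by
  have h1 : ∀ a b c, Integrable (fun ω => ∑ e, F a b c e ω) μ := fun a b c =>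
    integrable_finsetSum _ fun e _ => hF a b c e
  have h2 : ∀ a b, Integrable (fun ω => ∑ c, ∑ e, F a b c e ω) μ := fun a b =>
    integrable_finsetSum _ fun c _ => h1 a b c
  have h3 : ∀ a, Integrable (fun ω => ∑ b, ∑ c, ∑ e, F a b c e ω) μ := fun a =>
    integrable_finsetSum _ fun b _ => h2 a b
  rw [integral_finsetSum _ fun a _ => h3 a]
  refine Finset.sum_congr rfl fun a _ => ?_
  rw [integral_finsetSum _ fun b _ => h2 a b]
  refine Finset.sum_congr rfl fun b _ => ?_
  rw [integral_finsetSum _ fun c _ => h1 a b c]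
  refine Finset.sum_congr rfl fun c _ => ?_
  rw [integral_finsetSum _ fun e _ => hF a b c e]

/-- Contraction of an invariant tensor. -/
theorem sum_four_delta [DecidableEq ι] (α β : ℂ) (G : ι → ι → ι → ι → ℂ) :
    ∑ i, ∑ j, ∑ k, ∑ l, (α * (if i = j ∧ k = l then 1 else 0) +
        β * (if i = l ∧ k = j then 1 else 0)) * G i j k l =
      α * ∑ i, ∑ k, G i i k k + β * ∑ i, ∑ k, G i k k i := by
  have h1 : ∑ i, ∑ j, ∑ k, ∑ l, α * (if i = j ∧ k = l then 1 else 0) * G i j k l =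
      α * ∑ i, ∑ k, G i i k k := by
    simp_rw [mul_assoc, ← Finset.mul_sum, ite_mul, one_mul, zero_mul, ite_and]
    congr 1
    refine Finset.sum_congr rfl fun i _ => ?_
    rw [Finset.sum_eq_single i]
    · simp
    · intro j _ hj
      simp [hj.symm]
    · simp
  have h2 : ∑ i, ∑ j, ∑ k, ∑ l, β * (if i = l ∧ k = j then 1 else 0) * G i j k l =
      β * ∑ i, ∑ k, G i k k i := by
    simp_rw [mul_assoc, ← Finset.mul_sum, ite_mul, one_mul, zero_mul, ite_and]
    congr 1
    refine Finset.sum_congr rfl fun i _ => Finset.sum_congr rfl fun j _ => ?_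
    rw [Finset.sum_eq_single j]
    · simp
    · intro k _ hk
      simp [hk]
    · simp
  simp_rw [add_mul, Finset.sum_add_distrib]
  rw [h1, h2]

end Sums

section Moments

variable {n : ℕ}

instance unitaryHaar_isProbabilityMeasure : IsProbabilityMeasure (unitaryHaar n) :=
  ⟨Measure.haarMeasure_self (K₀ := ⊤)⟩

instance unitaryHaar_isMulLeftInvariant : (unitaryHaar n).IsMulLeftInvariant := by
  unfold unitaryHaar
  infer_instance

theorem continuous_unitary_entry (i j : Qubits n) :
    Continuous fun U : Matrix.unitaryGroup (Qubits n) ℂ => (U : Op n) i j :=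
  continuous_subtype_val.matrix_elem i j

/-- Left translation by W acts on row indices only, so Haar invariance is invariance of the moment
tensor at fixed column indices. The order i₁ k₁ i₂ k₂ alternates plain and conjugated slots, as
`UnitaryInvariant` requires. -/
theorem unitaryHaar_moment_invariant (j₁ j₂ l₁ l₂ : Qubits n) :
    UnitaryInvariant fun i₁ k₁ i₂ k₂ => ∫ U : Matrix.unitaryGroup (Qubits n) ℂ,
      (U : Op n) i₁ j₁ * (U : Op n) i₂ j₂ * star ((U : Op n) k₁ l₁) * star ((U : Op n) k₂ l₂)
        ∂(unitaryHaar n) := by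
  intro W hW i₁ k₁ i₂ k₂
  have hint : ∀ a b c e, Integrable (fun U : Matrix.unitaryGroup (Qubits n) ℂ =>
      (W i₁ a * star (W k₁ b) * (W i₂ c * star (W k₂ e))) *
      ((U : Op n) a j₁ * (U : Op n) c j₂ * star ((U : Op n) b l₁) * star ((U : Op n) e l₂)))
      (unitaryHaar n) := by
    intro a b c e
    refine Continuous.integrable_of_hasCompactSupport ?_ (HasCompactSupport.of_compactSpace _)
    exact continuous_const.mul ((((continuous_unitary_entry _ _).mul
      (continuous_unitary_entry _ _)).mul (continuous_unitary_entry _ _).star).mul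
      (continuous_unitary_entry _ _).star)
  have hr := integral_sum_four hint
  simp_rw [integral_const_mul] at hr
  refine Eq.trans ?_ hr
  refine (integral_mul_left_eq_self (μ := unitaryHaar n)
    (fun U : Matrix.unitaryGroup (Qubits n) ℂ =>
      (U : Op n) i₁ j₁ * (U : Op n) i₂ j₂ * star ((U : Op n) k₁ l₁) * star ((U : Op n) k₂ l₂))
    (⟨W, hW⟩ : Matrix.unitaryGroup (Qubits n) ℂ)).symm.trans ?_
  congr 1
  ext U
  simp only [Submonoid.coe_mul, Matrix.mul_apply, star_sum, star_mul']
  rw [mul_sum_four]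
  refine Finset.sum_congr rfl fun a _ => Finset.sum_congr rfl fun b _ =>
    Finset.sum_congr rfl fun c _ => Finset.sum_congr rfl fun e _ => ?_
  ring

variable {Ω : Type*} [MeasurableSpace Ω] {μ : Measure Ω}

theorem IsTwoDesign.exists_moment_eq [Nontrivial (Qubits n)] {V : Ω → Op n}
    (hV : IsTwoDesign μ V) : ∃ α β : Qubits n → Qubits n → Qubits n → Qubits n → ℂ,
      ∀ i₁ j₁ i₂ j₂ k₁ l₁ k₂ l₂,
        ∫ ω, V ω i₁ j₁ * V ω i₂ j₂ * star (V ω k₁ l₁) * star (V ω k₂ l₂) ∂μ =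
          α j₁ j₂ l₁ l₂ * (if i₁ = k₁ ∧ i₂ = k₂ then 1 else 0) +
            β j₁ j₂ l₁ l₂ * (if i₁ = k₂ ∧ i₂ = k₁ then 1 else 0) := by
  have h := fun j₁ j₂ l₁ l₂ => (unitaryHaar_moment_invariant (n := n) j₁ j₂ l₁ l₂).exists_eq
  choose α β h using h
  exact ⟨α, β, fun i₁ j₁ i₂ j₂ k₁ l₁ k₂ l₂ => (hV.2 ..).trans (h j₁ j₂ l₁ l₂ i₁ k₁ i₂ k₂)⟩

/-- All entries of the random operator `A` are essentially bounded. -/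
def BddOp (μ : Measure Ω) (A : Ω → Op n) : Prop := ∀ i j, MemLp (fun ω => A ω i j) ⊤ μ

theorem MemLp.mul_top {f g : Ω → ℂ} (hf : MemLp f ⊤ μ) (hg : MemLp g ⊤ μ) :
    MemLp (fun ω => f ω * g ω) ⊤ μ := hg.mul (r := ⊤) hf

theorem MemLp.star_top {f : Ω → ℂ} (hf : MemLp f ⊤ μ) : MemLp (fun ω => star (f ω)) ⊤ μ :=
  hf.star

namespace BddOp

variable {A B : Ω → Op n}

theorem const [IsProbabilityMeasure μ] (A : Op n) : BddOp μ fun _ => A := fun _ _ => memLp_const _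

theorem mul (hA : BddOp μ A) (hB : BddOp μ B) : BddOp μ fun ω => A ω * B ω := fun i j => by
  simp only [Matrix.mul_apply]
  exact memLp_finsetSum _ fun k _ => MemLp.mul_top (hA i k) (hB k j)

theorem conjTranspose (hA : BddOp μ A) : BddOp μ fun ω => (A ω)ᴴ := fun i j =>
  MemLp.star_top (hA j i)

theorem add (hA : BddOp μ A) (hB : BddOp μ B) : BddOp μ fun ω => A ω + B ω := fun i j =>
  MemLp.add (hA i j) (hB i j)

theorem sum {ι : Type*} (s : Finset ι) {A : ι → Ω → Op n} (hA : ∀ a, BddOp μ (A a)) :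
    BddOp μ fun ω => ∑ a ∈ s, A a ω := fun i j => by
  simp only [Matrix.sum_apply]
  exact memLp_finsetSum _ fun a _ => hA a i j

theorem smul (hA : BddOp μ A) (r : ℂ) : BddOp μ fun ω => r • A ω := fun i j =>
  MemLp.const_mul (hA i j) r

theorem trace (hA : BddOp μ A) : MemLp (fun ω => (A ω).trace) ⊤ μ :=
  memLp_finsetSum _ fun i _ => hA i i

end BddOp

/-- Continuous functions of the random operators `V` and `B` are uncorrelated. -/
def Decoupled (μ : Measure Ω) (V B : Ω → Op n) : Prop :=
  ∀ F G : Op n → ℂ, Continuous F → Continuous G →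
    ∫ ω, F (V ω) * G (B ω) ∂μ = (∫ ω, F (V ω) ∂μ) * ∫ ω, G (B ω) ∂μ

theorem Decoupled.const [IsProbabilityMeasure μ] (V : Ω → Op n) (B : Op n) :
    Decoupled μ V fun _ => B := fun F G _ _ => by
  simp [integral_mul_const]

/-- Contracting the column indices with K ⊗ K leaves the two pairings of the row indices intact;
only the coefficients change. -/
theorem IsTwoDesign.conj_moment_eq [Nontrivial (Qubits n)] [IsProbabilityMeasure μ]
    {V : Ω → Op n} (hV : IsTwoDesign μ V) (hb : BddOp μ V) (K : Op n) :
    ∃ α β : ℂ, ∀ i j k l, ∫ ω, (V ω * K * (V ω)ᴴ) i j * (V ω * K * (V ω)ᴴ) k l ∂μ =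
      α * (if i = j ∧ k = l then 1 else 0) + β * (if i = l ∧ k = j then 1 else 0) := by
  obtain ⟨α, β, h⟩ := hV.exists_moment_eq
  refine ⟨∑ a, ∑ b, ∑ c, ∑ e, K a b * K c e * α a c b e,
    ∑ a, ∑ b, ∑ c, ∑ e, K a b * K c e * β a c b e, fun i j k l => ?_⟩
  have e1 : ∀ ω, (V ω * K * (V ω)ᴴ) i j * (V ω * K * (V ω)ᴴ) k l =
      ∑ a, ∑ b, ∑ c, ∑ e, K a b * K c e *
        (V ω i a * V ω k c * star (V ω j b) * star (V ω l e)) := by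
    intro ω
    have : ∀ i j, (V ω * K * (V ω)ᴴ) i j = ∑ a, ∑ b, V ω i a * K a b * star (V ω j b) := by
      intro i j
      simp only [Matrix.mul_apply, Matrix.conjTranspose_apply, Finset.sum_mul]
      exact Finset.sum_comm
    rw [this, this]
    simp_rw [Finset.sum_mul, Finset.mul_sum]
    refine Finset.sum_congr rfl fun a _ => Finset.sum_congr rfl fun b _ =>
      Finset.sum_congr rfl fun c _ => Finset.sum_congr rfl fun e _ => ?_
    ring
  simp_rw [e1]
  rw [integral_sum_four]
  · simp_rw [integral_const_mul, h, Finset.sum_mul, ← Finset.sum_add_distrib]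
    refine Finset.sum_congr rfl fun a _ => Finset.sum_congr rfl fun b _ =>
      Finset.sum_congr rfl fun c _ => Finset.sum_congr rfl fun e _ => ?_
    ring
  · intro a b c e
    exact (MemLp.mul_top (MemLp.mul_top (MemLp.mul_top (hb i a) (hb k c))
      (MemLp.star_top (hb j b))) (MemLp.star_top (hb l e))).integrable le_top |>.const_mul _

/-- Decoupling splits each term into a moment of V and a mean of G(B); the two pairings of the
V-moment then contract the indices of G. -/
theorem integral_contraction [IsProbabilityMeasure μ] {V B : Ω → Op n} (hb : BddOp μ V)
    (hd : Decoupled μ V B) {K : Op n} {α β : ℂ}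
    (h : ∀ i j k l, ∫ ω, (V ω * K * (V ω)ᴴ) i j * (V ω * K * (V ω)ᴴ) k l ∂μ =
      α * (if i = j ∧ k = l then 1 else 0) + β * (if i = l ∧ k = j then 1 else 0))
    (G : Qubits n → Qubits n → Qubits n → Qubits n → Op n → ℂ)
    (hG : ∀ i j k l, Continuous (G i j k l))
    (hG' : ∀ i j k l, MemLp (fun ω => G i j k l (B ω)) ⊤ μ) :
    ∫ ω, ∑ i, ∑ j, ∑ k, ∑ l, (V ω * K * (V ω)ᴴ) i j * (V ω * K * (V ω)ᴴ) k l * G i j k l (B ω) ∂μ =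
      α * ∑ i, ∑ k, ∫ ω, G i i k k (B ω) ∂μ + β * ∑ i, ∑ k, ∫ ω, G i k k i (B ω) ∂μ := by
  have hX : BddOp μ fun ω => V ω * K * (V ω)ᴴ := (hb.mul (BddOp.const K)).mul hb.conjTranspose
  rw [integral_sum_four fun i j k l =>
    (MemLp.mul_top (MemLp.mul_top (hX i j) (hX k l)) (hG' i j k l)).integrable le_top]
  refine Eq.trans ?_ (sum_four_delta α β fun i j k l => ∫ ω, G i j k l (B ω) ∂μ)
  refine Finset.sum_congr rfl fun i _ => Finset.sum_congr rfl fun j _ =>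
      Finset.sum_congr rfl fun k _ => Finset.sum_congr rfl fun l _ => ?_
  rw [← h]
  refine hd (fun W => (W * K * Wᴴ) i j * (W * K * Wᴴ) k l) (G i j k l) ?_ (hG i j k l)
  have : Continuous fun W : Op n => W * K * Wᴴ := by fun_prop
  exact (this.matrix_elem i j).mul (this.matrix_elem k l)

/-- With X = VKV†, both tr(XB)² and tr(XBXB) contract X ⊗ X with B ⊗ B, and the two pairings
exchange roles between them. The constants do not depend on B, so they can be determined from B = 1.
-/
theorem IsTwoDesign.exists_trace_moments [Nontrivial (Qubits n)] [IsProbabilityMeasure μ]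
    {V : Ω → Op n} (hV : IsTwoDesign μ V) (hb : BddOp μ V) (K : Op n) :
    ∃ α β : ℂ, ∀ B : Ω → Op n, BddOp μ B → Decoupled μ V B →
      ∫ ω, (V ω * K * (V ω)ᴴ * B ω).trace ^ 2 ∂μ =
        α * ∫ ω, (B ω).trace ^ 2 ∂μ + β * ∫ ω, (B ω * B ω).trace ∂μ ∧
      ∫ ω, (V ω * K * (V ω)ᴴ * B ω * (V ω * K * (V ω)ᴴ * B ω)).trace ∂μ =
        α * ∫ ω, (B ω * B ω).trace ∂μ + β * ∫ ω, (B ω).trace ^ 2 ∂μ := by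
  obtain ⟨α, β, h⟩ := hV.conj_moment_eq hb K
  refine ⟨α, β, fun B hB hd => ?_⟩
  have hint : ∀ i j k l, Integrable (fun ω => B ω i j * B ω k l) μ := fun i j k l =>
    (MemLp.mul_top (hB i j) (hB k l)).integrable le_top
  have ht : ∫ ω, (B ω).trace ^ 2 ∂μ = ∑ i, ∑ k, ∫ ω, B ω i i * B ω k k ∂μ := by
    simp_rw [sq, Matrix.trace, Matrix.diag, Finset.sum_mul_sum]
    rw [integral_finsetSum _ fun i _ => integrable_finsetSum _ fun k _ => hint i i k k]
    exact Finset.sum_congr rfl fun i _ => integral_finsetSum _ fun k _ => hint i i k k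
  have ht' : ∫ ω, (B ω * B ω).trace ∂μ = ∑ i, ∑ k, ∫ ω, B ω i k * B ω k i ∂μ := by
    simp_rw [Matrix.trace, Matrix.diag, Matrix.mul_apply]
    rw [integral_finsetSum _ fun i _ => integrable_finsetSum _ fun k _ => hint i k k i]
    exact Finset.sum_congr rfl fun i _ => integral_finsetSum _ fun k _ => hint i k k i
  constructor
  · have e := integral_contraction hb hd h (fun i j k l W => W j i * W l k)
      (fun i j k l => by fun_prop) (fun i j k l => MemLp.mul_top (hB j i) (hB l k))
    rw [ht, ht']
    have e3 : ∑ i, ∑ k, ∫ ω, B ω i k * B ω k i ∂μ = ∑ i, ∑ k, ∫ ω, B ω k i * B ω i k ∂μ :=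
      Finset.sum_comm
    rw [e3, ← e]
    congr 1
    ext ω
    generalize V ω * K * (V ω)ᴴ = X
    simp_rw [sq, Matrix.trace, Matrix.diag, Matrix.mul_apply, Finset.sum_mul, Finset.mul_sum]
    refine Finset.sum_congr rfl fun a _ => Finset.sum_congr rfl fun b _ =>
      Finset.sum_congr rfl fun c _ => Finset.sum_congr rfl fun e _ => ?_
    ring
  · have e := integral_contraction hb hd h (fun i j k l W => W j k * W l i)
      (fun i j k l => by fun_prop) (fun i j k l => MemLp.mul_top (hB j k) (hB l i))
    have e4 : ∑ i, ∑ k, ∫ ω, B ω k k * B ω i i ∂μ = ∑ i, ∑ k, ∫ ω, B ω i i * B ω k k ∂μ :=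
      Finset.sum_comm
    rw [ht, ht', ← e4]
    refine Eq.trans ?_ e
    congr 1
    ext ω
    generalize V ω * K * (V ω)ᴴ = X
    simp_rw [Matrix.trace, Matrix.diag, Matrix.mul_apply, Finset.sum_mul, Finset.mul_sum]
    refine Finset.sum_congr rfl fun a _ => ?_
    rw [Finset.sum_comm]
    refine Eq.trans (Finset.sum_congr rfl fun _ _ => Finset.sum_comm) ?_
    refine Finset.sum_congr rfl fun j _ => ?_
    rw [Finset.sum_comm]
    refine Finset.sum_congr rfl fun k _ => Finset.sum_congr rfl fun l _ => ?_
    ring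

theorem trace_one_qubits : (1 : Op n).trace = (2 : ℂ) ^ n := by
  simp [Matrix.trace_one, Fintype.card_fin]

theorem one_lt_two_pow_of_nontrivial [Nontrivial (Qubits n)] : (1 : ℝ) < 2 ^ n := by
  have := Fintype.one_lt_card (α := Qubits n)
  simp only [Fintype.card_fun, Fintype.card_fin] at this
  exact_mod_cast this

theorem two_pow_algebra_ne_zero [Nontrivial (Qubits n)] : (2 : ℂ) ^ n ≠ 0 ∧
    (2 : ℂ) ^ n - 1 ≠ 0 ∧ (2 : ℂ) ^ n + 1 ≠ 0 := by
  have h := one_lt_two_pow_of_nontrivial (n := n)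
  refine ⟨by positivity, ?_, ?_⟩
  · have : (2 : ℝ) ^ n - 1 ≠ 0 := by linarith
    exact_mod_cast this
  · have : (2 : ℝ) ^ n + 1 ≠ 0 := by positivity
    exact_mod_cast this

theorem two_pow_sq_sub_one_ne_zero [Nontrivial (Qubits n)] : ((2 : ℂ) ^ n) ^ 2 - 1 ≠ 0 := by
  obtain ⟨-, h1, h2⟩ := two_pow_algebra_ne_zero (n := n)
  rw [show ((2 : ℂ) ^ n) ^ 2 - 1 = (2 ^ n - 1) * (2 ^ n + 1) by ring]
  exact mul_ne_zero h1 h2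

/-- Second moment of an expectation value in a random pure state. -/
theorem IsTwoDesign.integral_trace_sq_of_pure [Nontrivial (Qubits n)] [IsProbabilityMeasure μ]
    {V B : Ω → Op n} (hV : IsTwoDesign μ V) (hb : BddOp μ V) (hU : ∀ ω, (V ω)ᴴ * V ω = 1)
    (hB : BddOp μ B) (hd : Decoupled μ V B) (z : Qubits n) :
    ∫ ω, (V ω * Matrix.single z z 1 * (V ω)ᴴ * B ω).trace ^ 2 ∂μ =
      ((∫ ω, (B ω).trace ^ 2 ∂μ) + ∫ ω, (B ω * B ω).trace ∂μ) / (2 ^ n * (2 ^ n + 1)) := by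
  obtain ⟨α, β, h⟩ := hV.exists_trace_moments hb (Matrix.single z z 1)
  -- For B = 1 and a rank-one projector both left sides are 1: 1 = αd² + βd and 1 = αd + βd².
  obtain ⟨h1, h2⟩ := h _ (BddOp.const 1) (Decoupled.const V 1)
  have t1 : ∀ ω, (V ω * Matrix.single z z 1 * (V ω)ᴴ).trace = 1 := fun ω => by
    rw [Matrix.trace_mul_comm, ← mul_assoc, hU, one_mul, Matrix.trace_single_eq_same]
  have t2 : ∀ ω, V ω * Matrix.single z z 1 * (V ω)ᴴ * (V ω * Matrix.single z z 1 * (V ω)ᴴ) =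
      V ω * Matrix.single z z 1 * (V ω)ᴴ := fun ω => by
    calc _ = V ω * Matrix.single z z 1 * ((V ω)ᴴ * V ω) * Matrix.single z z 1 * (V ω)ᴴ := by
          simp only [mul_assoc]
      _ = _ := by simp [hU, mul_assoc]
  obtain ⟨hd0, hd1, hd2⟩ := two_pow_algebra_ne_zero (n := n)
  simp only [mul_one, t1, t2, trace_one_qubits, one_pow, integral_const, probReal_univ,
    one_smul] at h1 h2
  rw [(h B hB hd).1]
  generalize (2 : ℂ) ^ n = d at *
  have e1 : α = β := by
    have : (α - β) * (d * (d - 1)) = 0 := by linear_combination h2 - h1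
    rcases mul_eq_zero.mp this with h | h
    · exact sub_eq_zero.mp h
    · exact absurd h (mul_ne_zero hd0 hd1)
  have e2 : β = 1 / (d * (d + 1)) := by
    rw [eq_div_iff (mul_ne_zero hd0 hd2)]
    rw [e1] at h1
    linear_combination -h1
  rw [e1, e2]
  field_simp

/-- Mean expectation value in a random pure state. -/
theorem IsTwoDesign.integral_trace_of_pure [Nontrivial (Qubits n)] [IsProbabilityMeasure μ]
    {V B : Ω → Op n} (hV : IsTwoDesign μ V) (hb : BddOp μ V) (hU : ∀ ω, (V ω)ᴴ * V ω = 1)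
    (hB : BddOp μ B) (hd : Decoupled μ V B) (htr : ∀ ω, (B ω).trace = 0) (z : Qubits n) :
    ∫ ω, (V ω * Matrix.single z z 1 * (V ω)ᴴ * B ω).trace ∂μ = 0 := by
  -- The first moment is extracted from second moments: as the random state has trace 1, replacing B
  -- by B + 1 adds twice the wanted mean plus 1.
  have hd' : Decoupled μ V fun ω => B ω + 1 := fun F G hF hG =>
    hd F (fun W => G (W + 1)) hF (hG.comp (by fun_prop))
  have h1 := hV.integral_trace_sq_of_pure hb hU hB hd z
  have h2 := hV.integral_trace_sq_of_pure hb hU (hB.add (BddOp.const 1)) hd' z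
  have t1 : ∀ ω, (V ω * Matrix.single z z 1 * (V ω)ᴴ).trace = 1 := fun ω => by
    rw [Matrix.trace_mul_comm, ← mul_assoc, hU, one_mul, Matrix.trace_single_eq_same]
  have hX : MemLp (fun ω => (V ω * Matrix.single z z 1 * (V ω)ᴴ * B ω).trace) ⊤ μ :=
    (((hb.mul (BddOp.const _)).mul hb.conjTranspose).mul hB).trace
  have hi1 := hX.integrable le_top
  have hi2 := (MemLp.mul_top hX hX).integrable le_top
  simp only [← sq] at hi2
  have hBB := (hB.mul hB).trace.integrable le_top
  obtain ⟨hd0, hd1, hd2⟩ := two_pow_algebra_ne_zero (n := n)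
  have e1 : ∫ ω, (V ω * Matrix.single z z 1 * (V ω)ᴴ * (B ω + 1)).trace ^ 2 ∂μ =
      (∫ ω, (V ω * Matrix.single z z 1 * (V ω)ᴴ * B ω).trace ^ 2 ∂μ) +
        2 * (∫ ω, (V ω * Matrix.single z z 1 * (V ω)ᴴ * B ω).trace ∂μ) + 1 := by
    simp only [mul_add, mul_one, Matrix.trace_add, t1, add_sq, one_pow]
    have hi12 : Integrable (fun ω => (V ω * Matrix.single z z 1 * (V ω)ᴴ * B ω).trace ^ 2 +
      2 * (V ω * Matrix.single z z 1 * (V ω)ᴴ * B ω).trace) μ := hi2.add (hi1.const_mul 2)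
    rw [integral_add hi12 (integrable_const _), integral_add hi2 (hi1.const_mul 2), integral_const_mul]
    simp
  have e2 : ∫ ω, (B ω + 1).trace ^ 2 ∂μ = ((2 : ℂ) ^ n) ^ 2 := by
    simp [Matrix.trace_add, htr, -Matrix.trace_one, trace_one_qubits]
  have e3 : ∫ ω, ((B ω + 1) * (B ω + 1)).trace ∂μ =
      (∫ ω, (B ω * B ω).trace ∂μ) + (2 : ℂ) ^ n := by
    simp only [mul_add, add_mul, mul_one, one_mul, Matrix.trace_add, htr, trace_one_qubits,
      add_zero, zero_add]
    rw [integral_add hBB (integrable_const _)]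
    simp
  have e4 : ∫ ω, (B ω).trace ^ 2 ∂μ = 0 := by simp [htr]
  rw [e1, e2, e3, h1, e4] at h2
  generalize (2 : ℂ) ^ n = d at *
  field_simp at h2
  have : d * (d + 1) * 2 *
      (∫ ω, (V ω * Matrix.single z z 1 * (V ω)ᴴ * B ω).trace ∂μ) = 0 := by
    linear_combination h2
  simpa [hd0, hd2] using this

/-- Twirl of the out-of-time-order product of two traceless observables. -/
theorem IsTwoDesign.integral_trace_otoc [Nontrivial (Qubits n)] [IsProbabilityMeasure μ]
    {V B : Ω → Op n} (hV : IsTwoDesign μ V) (hb : BddOp μ V) (hU : ∀ ω, (V ω)ᴴ * V ω = 1)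
    (hB : BddOp μ B) (hd : Decoupled μ V B) (htr : ∀ ω, (B ω).trace = 0)
    {P : Op n} (hP : P.trace = 0) (hPP : P * P = 1) :
    ∫ ω, (P * ((V ω)ᴴ * B ω * V ω) * (P * ((V ω)ᴴ * B ω * V ω))).trace ∂μ =
      -(∫ ω, (B ω * B ω).trace ∂μ) / ((2 ^ n) ^ 2 - 1) := by
  obtain ⟨α, β, h⟩ := hV.exists_trace_moments hb P
  -- For B = 1 the conjugated P is traceless with square 1: 0 = αd² + βd and d = αd + βd². Only α
  -- matters, since the actual B is traceless.
  obtain ⟨h1, h2⟩ := h _ (BddOp.const 1) (Decoupled.const V 1)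
  have hU' : ∀ ω, V ω * (V ω)ᴴ = 1 := fun ω => mul_eq_one_comm.mp (hU ω)
  have t1 : ∀ ω, (V ω * P * (V ω)ᴴ).trace = 0 := fun ω => by
    rw [Matrix.trace_mul_comm, ← mul_assoc, hU, one_mul, hP]
  have t2 : ∀ ω, V ω * P * (V ω)ᴴ * (V ω * P * (V ω)ᴴ) = 1 := fun ω => by
    calc _ = V ω * P * ((V ω)ᴴ * V ω) * P * (V ω)ᴴ := by simp only [mul_assoc]
      _ = V ω * (P * P) * (V ω)ᴴ := by rw [hU]; simp [mul_assoc]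
      _ = _ := by rw [hPP, mul_one, hU']
  have t3 : ∀ ω, (P * ((V ω)ᴴ * B ω * V ω) * (P * ((V ω)ᴴ * B ω * V ω))).trace =
      (V ω * P * (V ω)ᴴ * B ω * (V ω * P * (V ω)ᴴ * B ω)).trace := fun ω => by
    calc _ = ((P * (V ω)ᴴ * B ω * V ω * P * (V ω)ᴴ * B ω) * V ω).trace := by
          simp only [mul_assoc]
      _ = _ := by rw [Matrix.trace_mul_comm]; simp only [mul_assoc]
  obtain ⟨hd0, hd1, hd2⟩ := two_pow_algebra_ne_zero (n := n)
  simp only [mul_one, t1, t2, trace_one_qubits, integral_const, probReal_univ,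
    one_smul] at h1 h2
  simp only [t3]
  rw [(h B hB hd).2]
  simp only [htr]
  have hne := two_pow_sq_sub_one_ne_zero (n := n)
  generalize (2 : ℂ) ^ n = d at *
  have hα : α = -1 / (d ^ 2 - 1) := by
    rw [eq_div_iff hne]
    have : d * (α * (d ^ 2 - 1) + 1) = 0 := by linear_combination h2 - d * h1
    linear_combination (mul_eq_zero.mp this).resolve_left hd0
  rw [hα]
  simp
  ring

end Moments

/-! ### Statistics of independent measurement data -/

section Sampling

/-- Second moment of `c` plus a sum of independent variables, the laws of which are given by the
weights `p i`. -/
theorem sum_prod_mul_sq {κ : Type*} [Fintype κ] :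
    ∀ {r : ℕ} (p u : Fin r → κ → ℝ) (_ : ∀ i, ∑ k, p i k = 1) (c : ℝ),
      ∑ x : Fin r → κ, (∏ i, p i (x i)) * (c + ∑ i, u i (x i)) ^ 2 =
        (c + ∑ i, ∑ k, p i k * u i k) ^ 2 +
          ∑ i, ((∑ k, p i k * u i k ^ 2) - (∑ k, p i k * u i k) ^ 2)
  | 0, p, u, hp, c => by simp
  | r + 1, p, u, hp, c => by
    -- Conditioning on the first variable moves its value into the constant `c` of the induction
    -- hypothesis.
    rw [← (Fin.consEquiv fun _ : Fin (r + 1) => κ).sum_comp, Fintype.sum_prod_type]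
    have ih := fun k => sum_prod_mul_sq (fun i => p i.succ) (fun i => u i.succ)
      (fun i => hp i.succ) (c + u 0 k)
    simp only [Fin.consEquiv, Equiv.coe_fn_mk, Fin.prod_univ_succ, Fin.sum_univ_succ,
      Fin.cons_zero, Fin.cons_succ, mul_assoc, ← Finset.mul_sum, ← add_assoc, ih]
    generalize ∑ i : Fin r, ∑ k, p i.succ k * u i.succ k = m
    generalize ∑ i : Fin r, ((∑ k, p i.succ k * u i.succ k ^ 2) -
      (∑ k, p i.succ k * u i.succ k) ^ 2) = v
    have e : ∀ k, p 0 k * ((c + u 0 k + m) ^ 2 + v) =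
        p 0 k * u 0 k ^ 2 + (2 * (c + m)) * (p 0 k * u 0 k) + ((c + m) ^ 2 + v) * p 0 k :=
      fun k => by ring
    simp only [e, Finset.sum_add_distrib, ← Finset.mul_sum, hp]
    ring

/-- Mean of a sum of independent variables. -/
theorem sum_prod_mul {κ : Type*} [Fintype κ] {r : ℕ} (p u : Fin r → κ → ℝ)
    (hp : ∀ i, ∑ k, p i k = 1) :
    ∑ x : Fin r → κ, (∏ i, p i (x i)) * ∑ i, u i (x i) = ∑ i, ∑ k, p i k * u i k := by
  -- Polarization: S = ((1+S)² - (-1+S)²)/4.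
  have h1 := sum_prod_mul_sq p u hp 1
  have h2 := sum_prod_mul_sq p u hp (-1)
  have e : ∀ x : Fin r → κ, (∏ i, p i (x i)) * ∑ i, u i (x i) =
      ((∏ i, p i (x i)) * (1 + ∑ i, u i (x i)) ^ 2 -
        (∏ i, p i (x i)) * (-1 + ∑ i, u i (x i)) ^ 2) / 4 := fun x => by ring
  simp only [e, ← Finset.sum_div, Finset.sum_sub_distrib, h1, h2]
  ring

theorem sum_prod_eq_one {κ : Type*} [Fintype κ] [DecidableEq κ] {r : ℕ} (p : Fin r → κ → ℝ)
    (hp : ∀ i, ∑ k, p i k = 1) : ∑ x : Fin r → κ, ∏ i, p i (x i) = 1 := by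
  have h := Finset.prod_univ_sum (fun _ : Fin r => (Finset.univ : Finset κ)) p
  rw [Fintype.piFinset_univ] at h
  rw [← h]
  simp [hp]

variable {n N : ℕ} {p : Qubits n → ℝ} {o : Qubits n → ℝ}

theorem sum_sampleMean (hN : 1 ≤ N) (hp : ∑ k, p k = 1) :
    ∑ x : Fin N → Qubits n, (∏ j, p (x j)) * sampleMean o x = ∑ k, p k * o k := by
  have hN' : (N : ℝ) ≠ 0 := by positivity
  have := sum_prod_mul (fun _ : Fin N => p) (fun _ => o) fun _ => hp
  simp only [Finset.sum_const, Finset.card_univ, Fintype.card_fin, nsmul_eq_mul] at this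
  simp only [sampleMean, mul_div_assoc', ← Finset.sum_div, this]
  field_simp

theorem sum_sampleMean_sq (hN : 1 ≤ N) (hp : ∑ k, p k = 1) (ho : ∀ k, o k ^ 2 = 1) :
    ∑ x : Fin N → Qubits n, (∏ j, p (x j)) * sampleMean o x ^ 2 =
      (∑ k, p k * o k) ^ 2 + (1 - (∑ k, p k * o k) ^ 2) / N := by
  have hN' : (N : ℝ) ≠ 0 := by positivity
  have := sum_prod_mul_sq (fun _ : Fin N => p) (fun _ => o) (fun _ => hp) 0
  simp only [Finset.sum_const, Finset.card_univ, Fintype.card_fin, nsmul_eq_mul, zero_add, ho,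
    mul_one, hp] at this
  simp only [sampleMean, div_pow, mul_div_assoc', ← Finset.sum_div, this]
  field_simp

/-- Conditional mean-squared error of a scaled linear combination of sample means, for data with
the outcome probabilities `p a`. -/
theorem sum_data_sq {r : ℕ} (w : Fin r → ℝ) (p : Fin r → Qubits n → ℝ)
    (hp : ∀ a, ∑ k, p a k = 1) (ho : ∀ k, o k ^ 2 = 1) (hN : 1 ≤ N) (lam D : ℝ) :
    ∑ x : Fin r → Fin N → Qubits n, (∏ a, ∏ j, p a (x a j)) *
        (lam * ∑ a, w a * sampleMean o (x a) - D) ^ 2 =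
      lam ^ 2 / N * ∑ a, w a ^ 2 * (1 - (∑ k, p a k * o k) ^ 2) +
        (lam * ∑ a, w a * ∑ k, p a k * o k - D) ^ 2 := by
  -- Independence is used on a second level: the independent variables are now whole data blocks,
  -- one for each sampled function value, and the constant is -D.
  have h := sum_prod_mul_sq (fun a (y : Fin N → Qubits n) => ∏ j, p a (y j))
    (fun a y => lam * w a * sampleMean o y) (fun a => sum_prod_eq_one _ fun _ => hp a) (-D)
  have e1 : ∀ a, ∑ y : Fin N → Qubits n, (∏ j, p a (y j)) * (lam * w a * sampleMean o y) =
      lam * (w a * ∑ k, p a k * o k) := fun a => by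
    rw [← sum_sampleMean hN (hp a), ← mul_assoc, Finset.mul_sum]
    exact Finset.sum_congr rfl fun y _ => by ring
  have e2 : ∀ a, ∑ y : Fin N → Qubits n, (∏ j, p a (y j)) * (lam * w a * sampleMean o y) ^ 2 =
      (lam * w a) ^ 2 * ((∑ k, p a k * o k) ^ 2 + (1 - (∑ k, p a k * o k) ^ 2) / N) := fun a => by
    rw [← sum_sampleMean_sq hN (hp a) ho, Finset.mul_sum]
    exact Finset.sum_congr rfl fun y _ => by ring
  simp only [e1, e2, ← Finset.mul_sum] at h
  have e3 : ∀ x : Fin r → Fin N → Qubits n, lam * ∑ a, w a * sampleMean o (x a) - D =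
      -D + ∑ a, lam * w a * sampleMean o (x a) := fun x => by
    rw [Finset.mul_sum, sub_eq_neg_add]
    simp only [mul_assoc]
  simp only [e3, h]
  rw [add_comm, sub_eq_neg_add]
  congr 1
  rw [Finset.mul_sum]
  exact Finset.sum_congr rfl fun a _ => by ring

end Sampling

/-! ### Pauli operators and rotations -/

section Pauli

variable {n : ℕ}

theorem pauliFactor_mul_self (a : Option Axis) : pauliFactor a * pauliFactor a = 1 := by
  rcases a with _ | _ | _ | _ <;>
    simp [pauliFactor, Axis.sigma, Matrix.one_fin_two]

theorem pauliFactor_conjTranspose (a : Option Axis) : (pauliFactor a)ᴴ = pauliFactor a := by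
  rcases a with _ | _ | _ | _
  · simp [pauliFactor]
  all_goals
    ext i j
    fin_cases i <;> fin_cases j <;> simp [pauliFactor, Axis.sigma]

theorem pauliFactor_trace (a : Axis) : (pauliFactor (some a)).trace = 0 := by
  cases a <;> simp [pauliFactor, Axis.sigma, Matrix.trace_fin_two]

theorem pauliString_mul_self (s : Fin n → Option Axis) : pauliString s * pauliString s = 1 := by
  ext x z
  have h := Finset.prod_univ_sum (fun _ : Fin n => (Finset.univ : Finset (Fin 2)))
    fun q b => pauliFactor (s q) (x q) b * pauliFactor (s q) b (z q)
  rw [Fintype.piFinset_univ] at h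
  simp only [pauliString, Matrix.mul_apply, Matrix.of_apply, ← Finset.prod_mul_distrib]
  rw [← h]
  simp only [← Matrix.mul_apply, pauliFactor_mul_self, Matrix.one_apply]
  rw [Finset.prod_ite_zero]
  simp [funext_iff]

theorem pauliString_conjTranspose (s : Fin n → Option Axis) :
    (pauliString s)ᴴ = pauliString s := by
  ext x z
  simp only [pauliString, Matrix.conjTranspose_apply, Matrix.of_apply, star_prod]
  refine Finset.prod_congr rfl fun q _ => ?_
  rw [← Matrix.conjTranspose_apply, pauliFactor_conjTranspose]

theorem pauliString_trace {s : Fin n → Option Axis} (hs : ∃ q, s q ≠ none) :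
    (pauliString s).trace = 0 := by
  obtain ⟨q, hq⟩ := hs
  have h := Finset.prod_univ_sum (fun _ : Fin n => (Finset.univ : Finset (Fin 2)))
    fun q b => pauliFactor (s q) b b
  rw [Fintype.piFinset_univ] at h
  simp only [pauliString, Matrix.trace, Matrix.diag, Matrix.of_apply]
  rw [← h]
  obtain ⟨a, ha⟩ := Option.ne_none_iff_exists'.mp hq
  refine Finset.prod_eq_zero (Finset.mem_univ q) ?_
  rw [ha]
  exact pauliFactor_trace a

theorem singlePauli_trace (q : Fin n) (a : Axis) : (singlePauli q a).trace = 0 :=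
  pauliString_trace ⟨q, by simp⟩

theorem singlePauli_mul_self (q : Fin n) (a : Axis) : singlePauli q a * singlePauli q a = 1 :=
  pauliString_mul_self _

theorem singlePauli_conjTranspose (q : Fin n) (a : Axis) :
    (singlePauli q a)ᴴ = singlePauli q a :=
  pauliString_conjTranspose _

theorem pauliRotation_conjTranspose {P : Op n} (hP : Pᴴ = P) (t : ℝ) :
    (pauliRotation P t)ᴴ =
      (Real.cos (t / 2) : ℂ) • (1 : Op n) + (Complex.I * (Real.sin (t / 2) : ℂ)) • P := by
  simp only [pauliRotation, Matrix.conjTranspose_sub, Matrix.conjTranspose_smul, hP,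
    Matrix.conjTranspose_one, star_mul', RCLike.star_def, Complex.conj_ofReal, Complex.conj_I]
  module

theorem pauliRotation_zero (P : Op n) : pauliRotation P 0 = 1 := by simp [pauliRotation]

theorem pauliRotation_add {P : Op n} (hPP : P * P = 1) (s t : ℝ) :
    pauliRotation P (s + t) = pauliRotation P s * pauliRotation P t := by
  simp only [pauliRotation, sub_mul, mul_sub, smul_mul_smul_comm, one_mul, mul_one, hPP, add_div,
    Real.cos_add, Real.sin_add]
  push_cast
  match_scalars
  · linear_combination (-Complex.sin (s / 2) * Complex.sin (t / 2)) * Complex.I_mul_I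
  · ring

theorem pauliRotation_neg {P : Op n} (hP : Pᴴ = P) (t : ℝ) :
    pauliRotation P (-t) = (pauliRotation P t)ᴴ := by
  rw [pauliRotation_conjTranspose hP]
  simp only [pauliRotation, neg_div, Real.cos_neg, Real.sin_neg]
  push_cast
  module

theorem pauliRotation_unitary {P : Op n} (hP : Pᴴ = P) (hPP : P * P = 1) (t : ℝ) :
    (pauliRotation P t)ᴴ * pauliRotation P t = 1 := by
  rw [← pauliRotation_neg hP, ← pauliRotation_add hPP, neg_add_cancel, pauliRotation_zero]

/-- The Heisenberg picture of an observable under a Pauli rotation. -/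
theorem pauliRotation_conj {P : Op n} (hP : Pᴴ = P) (A : Op n) (t : ℝ) :
    (pauliRotation P t)ᴴ * A * pauliRotation P t =
      (Real.cos (t / 2) ^ 2 : ℂ) • A + (Real.sin (t / 2) ^ 2 : ℂ) • (P * A * P) +
        (Complex.I * Real.cos (t / 2) * Real.sin (t / 2)) • (P * A - A * P) := by
  rw [pauliRotation_conjTranspose hP, pauliRotation]
  simp only [add_mul, mul_sub, smul_mul_assoc, mul_smul_comm, one_mul, mul_one, smul_sub]
  match_scalars
  · ring
  · ring
  · ring
  · linear_combination (-Complex.sin (t / 2) * Complex.sin (t / 2)) * Complex.I_mul_I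

/-- The first-order parameter-shift combination of rotated observables. -/
noncomputable def shiftDiff (P A : Op n) (t : ℝ) : Op n :=
  (1 / 2 : ℂ) • ((pauliRotation P (t + Real.pi / 2))ᴴ * A * pauliRotation P (t + Real.pi / 2)) -
    (1 / 2 : ℂ) • ((pauliRotation P (t + -Real.pi / 2))ᴴ * A * pauliRotation P (t + -Real.pi / 2))

/-- The second-order parameter-shift combination of rotated observables. -/
noncomputable def shiftDiff₂ (P A : Op n) (t : ℝ) : Op n :=
  (1 / 4 : ℂ) • ((pauliRotation P (t + Real.pi))ᴴ * A * pauliRotation P (t + Real.pi)) -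
    (1 / 2 : ℂ) • ((pauliRotation P t)ᴴ * A * pauliRotation P t) +
    (1 / 4 : ℂ) • ((pauliRotation P (t + -Real.pi))ᴴ * A * pauliRotation P (t + -Real.pi))

theorem pauliRotation_conj_add {P : Op n} (hPP : P * P = 1) (A : Op n) (s t : ℝ) :
    (pauliRotation P (t + s))ᴴ * A * pauliRotation P (t + s) =
      (pauliRotation P t)ᴴ * ((pauliRotation P s)ᴴ * A * pauliRotation P s) *
        pauliRotation P t := by
  rw [add_comm t s, pauliRotation_add hPP, Matrix.conjTranspose_mul]
  simp only [mul_assoc]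

/-- The group law factors out the rotation at t, so the combination at t = 0 decides. There cos² and
sin² take the same values for both shifts and cancel, leaving the commutator term. -/
theorem shiftDiff_eq {P : Op n} (hP : Pᴴ = P) (hPP : P * P = 1) (A : Op n) (t : ℝ) :
    shiftDiff P A t = (pauliRotation P t)ᴴ * ((Complex.I / 2) • (P * A - A * P)) *
      pauliRotation P t := by
  have e : (1 / 2 : ℂ) • ((pauliRotation P (Real.pi / 2))ᴴ * A * pauliRotation P (Real.pi / 2)) -
      (1 / 2 : ℂ) • ((pauliRotation P (-Real.pi / 2))ᴴ * A * pauliRotation P (-Real.pi / 2)) =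
      (Complex.I / 2) • (P * A - A * P) := by
    rw [pauliRotation_conj hP, pauliRotation_conj hP]
    have h1 : Real.pi / 2 / 2 = Real.pi / 4 := by ring
    have h2 : -Real.pi / 2 / 2 = -(Real.pi / 4) := by ring
    have h3 : ((Real.sqrt 2 : ℝ) : ℂ) * (Real.sqrt 2 : ℝ) = 2 := by
      rw [← Complex.ofReal_mul, Real.mul_self_sqrt (by norm_num)]
      simp
    rw [h1, h2, Real.cos_neg, Real.sin_neg, Real.cos_pi_div_four, Real.sin_pi_div_four]
    push_cast
    match_scalars
    · ring
    · ring
    · linear_combination (Complex.I / 4) * h3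
    · linear_combination (-Complex.I / 4) * h3
  rw [shiftDiff, pauliRotation_conj_add hPP, pauliRotation_conj_add hPP, ← e]
  simp only [mul_sub, sub_mul, mul_smul_comm, smul_mul_assoc]

/-- Rotations by ±π are ∓iP, so both outer terms turn A into PAP. -/
theorem shiftDiff₂_eq {P : Op n} (hP : Pᴴ = P) (hPP : P * P = 1) (A : Op n) (t : ℝ) :
    shiftDiff₂ P A t = (pauliRotation P t)ᴴ * ((1 / 2 : ℂ) • (P * A * P - A)) *
      pauliRotation P t := by
  have e : (1 / 4 : ℂ) • ((pauliRotation P Real.pi)ᴴ * A * pauliRotation P Real.pi) -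
      (1 / 2 : ℂ) • A +
      (1 / 4 : ℂ) • ((pauliRotation P (-Real.pi))ᴴ * A * pauliRotation P (-Real.pi)) =
      (1 / 2 : ℂ) • (P * A * P - A) := by
    rw [pauliRotation_conj hP, pauliRotation_conj hP, neg_div, Real.cos_neg, Real.sin_neg,
      Real.cos_pi_div_two, Real.sin_pi_div_two]
    push_cast
    module
  rw [shiftDiff₂, pauliRotation_conj_add hPP, pauliRotation_conj_add hPP, ← e]
  simp only [mul_sub, sub_mul, mul_add, add_mul, mul_smul_comm, smul_mul_assoc]

theorem trace_conj_eq {R : Op n} (hR : Rᴴ * R = 1) (A : Op n) : (Rᴴ * A * R).trace = A.trace := by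
  rw [Matrix.trace_mul_comm, ← mul_assoc, mul_eq_one_comm.mp hR, one_mul]

theorem trace_conj_sq_eq {R : Op n} (hR : Rᴴ * R = 1) (A : Op n) :
    (Rᴴ * A * R * (Rᴴ * A * R)).trace = (A * A).trace := by
  rw [← trace_conj_eq hR (A * A)]
  congr 1
  calc _ = Rᴴ * A * (R * Rᴴ) * A * R := by simp only [mul_assoc]
    _ = _ := by rw [mul_eq_one_comm.mp hR, mul_one]; simp only [mul_assoc]

theorem shiftDiff_trace {P : Op n} (hP : Pᴴ = P) (hPP : P * P = 1) (A : Op n) (t : ℝ) :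
    (shiftDiff P A t).trace = 0 := by
  rw [shiftDiff_eq hP hPP, trace_conj_eq (pauliRotation_unitary hP hPP t), Matrix.trace_smul,
    Matrix.trace_sub, Matrix.trace_mul_comm, sub_self, smul_zero]

theorem shiftDiff_sq_trace {P : Op n} (hP : Pᴴ = P) (hPP : P * P = 1) (A : Op n) (t : ℝ) :
    (shiftDiff P A t * shiftDiff P A t).trace =
      ((A * A).trace - (P * A * (P * A)).trace) / 2 := by
  rw [shiftDiff_eq hP hPP, trace_conj_sq_eq (pauliRotation_unitary hP hPP t), smul_mul_smul_comm,
    Matrix.trace_smul]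
  have h1 : (P * A * (A * P)).trace = (A * A).trace := by
    rw [Matrix.trace_mul_comm, show A * P * (P * A) = A * (P * P) * A by simp only [mul_assoc],
      hPP, mul_one]
  have h2 : (A * P * (P * A)).trace = (A * A).trace := by
    rw [show A * P * (P * A) = A * (P * P) * A by simp only [mul_assoc], hPP, mul_one]
  have h3 : (A * P * (A * P)).trace = (P * A * (P * A)).trace := by
    rw [mul_assoc, Matrix.trace_mul_comm]
    simp only [mul_assoc]
  simp only [mul_sub, sub_mul, Matrix.trace_sub, h1, h2, h3, smul_eq_mul]
  linear_combination ((P * A * (P * A)).trace - (A * A).trace) / 2 * Complex.I_mul_I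

/-- Here (PAP - A)/2 = [P,A]P/2, and P anticommutes with [P,A], so the square is -[P,A]²/4 as in the
first-order case. Hence gradient and diagonal Hessian share their mean square. -/
theorem shiftDiff₂_sq_trace {P : Op n} (hP : Pᴴ = P) (hPP : P * P = 1) (A : Op n) (t : ℝ) :
    (shiftDiff₂ P A t * shiftDiff₂ P A t).trace =
      ((A * A).trace - (P * A * (P * A)).trace) / 2 := by
  rw [shiftDiff₂_eq hP hPP, trace_conj_sq_eq (pauliRotation_unitary hP hPP t), smul_mul_smul_comm,
    Matrix.trace_smul]
  have h1 : (P * A * P * (P * A * P)).trace = (A * A).trace := by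
    rw [show P * A * P * (P * A * P) = P * (A * (P * P) * A * P) by simp only [mul_assoc], hPP,
      mul_one, Matrix.trace_mul_comm, mul_assoc, hPP, mul_one]
  have h2 : (A * (P * A * P)).trace = (P * A * (P * A)).trace := by
    rw [show A * (P * A * P) = (A * (P * A)) * P by simp only [mul_assoc], Matrix.trace_mul_comm]
    simp only [mul_assoc]
  have h3 : (P * A * P * A).trace = (P * A * (P * A)).trace := by simp only [mul_assoc]
  simp only [mul_sub, sub_mul, Matrix.trace_sub, h1, h2, h3, smul_eq_mul]
  ring

end Pauli

/-! ### Circuit segments -/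

namespace PauliCircuit

variable {n m : ℕ} (c : PauliCircuit n m)

/-- The Pauli operator of the encoded gate `k`. -/
noncomputable def pauli (k : Fin m) : Op n := singlePauli (c.qubit k) (c.axis k)

theorem pauli_conjTranspose (k : Fin m) : (c.pauli k)ᴴ = c.pauli k :=
  singlePauli_conjTranspose _ _

theorem pauli_mul_self (k : Fin m) : c.pauli k * c.pauli k = 1 := singlePauli_mul_self _ _

theorem pauli_trace (k : Fin m) : (c.pauli k).trace = 0 := singlePauli_trace _ _

theorem gate_eq (θ : Fin m → ℝ) (k : Fin m) : c.gate θ k = pauliRotation (c.pauli k) (θ k) := by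
  simp [gate, pauli]

theorem gate_unitary (θ : Fin m → ℝ) (i : ℕ) : (c.gate θ i)ᴴ * c.gate θ i = 1 := by
  unfold gate
  split_ifs with h
  · exact pauliRotation_unitary (singlePauli_conjTranspose _ _) (singlePauli_mul_self _ _) _
  · simp

theorem fixed_unitary (i : ℕ) : (c.fixed i : Op n)ᴴ * (c.fixed i : Op n) = 1 :=
  Matrix.mem_unitaryGroup_iff'.mp (c.fixed i).2

theorem conjTranspose_mul_mul_cancel {A B : Op n} (hA : Aᴴ * A = 1) (hB : Bᴴ * B = 1) :
    (A * B)ᴴ * (A * B) = 1 := by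
  rw [Matrix.conjTranspose_mul, show Bᴴ * Aᴴ * (A * B) = Bᴴ * (Aᴴ * A) * B by
    simp only [mul_assoc], hA, mul_one, hB]

theorem segment_unitary (θ : Fin m → ℝ) (a : ℕ) :
    ∀ len, (c.segment θ a len)ᴴ * c.segment θ a len = 1
  | 0 => c.fixed_unitary a
  | len + 1 => conjTranspose_mul_mul_cancel
      (conjTranspose_mul_mul_cancel (c.fixed_unitary _) (c.gate_unitary _ _))
      (segment_unitary θ a len)

theorem continuous_gate (i : ℕ) : Continuous fun θ => c.gate θ i := by
  unfold gate
  split_ifs with h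
  · unfold pauliRotation
    fun_prop
  · exact continuous_const

theorem continuous_segment (a : ℕ) : ∀ len, Continuous fun θ => c.segment θ a len
  | 0 => continuous_const
  | len + 1 => (continuous_const.mul (c.continuous_gate _)).mul (continuous_segment a len)

theorem gate_congr {θ θ' : Fin m → ℝ} {i : ℕ} (h : ∀ k : Fin m, k.val = i → θ k = θ' k) :
    c.gate θ i = c.gate θ' i := by
  unfold gate
  split_ifs with hi
  · rw [h ⟨i, hi⟩ rfl]
  · rfl

theorem segment_congr {θ θ' : Fin m → ℝ} {a : ℕ} : ∀ {len : ℕ}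
    (_ : ∀ k : Fin m, a ≤ k.val → k.val < a + len → θ k = θ' k),
    c.segment θ a len = c.segment θ' a len
  | 0, _ => rfl
  | len + 1, h => by
    rw [segment, segment, c.gate_congr fun k hk => h k (by omega) (by omega),
      segment_congr fun k h1 h2 => h k h1 (by omega)]

theorem segment_split (θ : Fin m → ℝ) (a len : ℕ) : ∀ len',
    c.segment θ a (len + 1 + len') =
      c.segment θ (a + len + 1) len' * c.gate θ (a + len) * c.segment θ a len
  | 0 => rfl
  | len' + 1 => by
    rw [← add_assoc, segment, segment_split θ a len len', segment]
    have e : a + (len + 1 + len') = a + len + 1 + len' := by omega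
    rw [e]
    simp only [mul_assoc]

theorem segment_eq_of_mem (θ : Fin m → ℝ) {a len : ℕ} (k : Fin m) (h1 : a ≤ k.val)
    (h2 : k.val < a + len) :
    c.segment θ a len = c.segment θ (k.val + 1) (a + len - (k.val + 1)) *
      pauliRotation (c.pauli k) (θ k) * c.segment θ a (k.val - a) := by
  have e : len = (k.val - a) + 1 + (a + len - (k.val + 1)) := by omega
  conv_lhs => rw [e, segment_split]
  have e2 : a + (k.val - a) = k.val := by omega
  rw [e2, c.gate_eq]

/-- The observable `O` in the Heisenberg picture of all operations after the operators that
precede the encoded gate `k`. -/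
noncomputable def heisenberg (O : Op n) (k : Fin m) (θ : Fin m → ℝ) : Op n :=
  (pauliRotation (c.pauli k) (θ k))ᴴ *
    ((c.segment θ (k.val + 1) (m - (k.val + 1)))ᴴ * O * c.segment θ (k.val + 1) (m - (k.val + 1))) *
    pauliRotation (c.pauli k) (θ k)

theorem unitary_eq (θ : Fin m → ℝ) (k : Fin m) :
    c.unitary θ = c.segment θ (k.val + 1) (m - (k.val + 1)) *
      pauliRotation (c.pauli k) (θ k) * c.segment θ 0 k.val := by
  rw [PauliCircuit.unitary, c.segment_eq_of_mem θ k (Nat.zero_le _) (by simp)]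
  simp

theorem trace_state_mul (O : Op n) (θ : Fin m → ℝ) :
    (c.state θ * O).trace = ((c.unitary θ)ᴴ * O * c.unitary θ) 0 0 := by
  rw [state, Matrix.mul_assoc, Matrix.trace_mul_comm, ← Matrix.mul_assoc, Matrix.trace_mul_single]
  simp

theorem value_eq {O : Op n} (hO : Oᴴ = O) (θ : Fin m → ℝ) :
    (c.value O θ : ℂ) = (c.state θ * O).trace := by
  rw [trace_state_mul, value]
  apply Matrix.IsHermitian.coe_re_apply_self
  rw [Matrix.IsHermitian, Matrix.conjTranspose_mul, Matrix.conjTranspose_mul, hO,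
    Matrix.conjTranspose_conjTranspose, mul_assoc]

/-- This is the cut at which independence applies: the state involves only parameters before k, the
observable only k and later ones. -/
theorem value_eq_heisenberg {O : Op n} (hO : Oᴴ = O) (k : Fin m) (θ : Fin m → ℝ) :
    (c.value O θ : ℂ) = (c.segment θ 0 k.val * Matrix.single 0 0 1 * (c.segment θ 0 k.val)ᴴ *
      c.heisenberg O k θ).trace := by
  rw [c.value_eq hO, state, c.unitary_eq θ k, heisenberg]
  simp only [Matrix.conjTranspose_mul]
  generalize c.segment θ (k.val + 1) (m - (k.val + 1)) = A
  generalize pauliRotation (c.pauli k) (θ k) = R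
  generalize c.segment θ 0 k.val = V
  calc _ = (A * (R * (V * Matrix.single 0 0 1 * Vᴴ * Rᴴ * Aᴴ * O))).trace := by
        simp only [mul_assoc]
    _ = _ := by
      rw [Matrix.trace_mul_comm, mul_assoc, Matrix.trace_mul_comm]
      simp only [mul_assoc]

theorem unitary_unitary (θ : Fin m → ℝ) : (c.unitary θ)ᴴ * c.unitary θ = 1 :=
  c.segment_unitary θ 0 m

theorem state_trace (θ : Fin m → ℝ) : (c.state θ).trace = 1 := by
  rw [state, Matrix.trace_mul_comm, ← mul_assoc, unitary_unitary, one_mul,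
    Matrix.trace_single_eq_same]

theorem continuous_value (O : Op n) : Continuous (c.value O) := by
  have h : Continuous fun θ => (c.unitary θ)ᴴ * O * c.unitary θ := by
    have := c.continuous_segment 0 m
    exact (this.matrix_conjTranspose.mul continuous_const).mul this
  exact Complex.continuous_re.comp (h.matrix_elem 0 0)

/-- The value is the real part of an entry of the unitary matrix U†OU. -/
theorem abs_value_le {O : Op n} (hO : Oᴴ * O = 1) (θ : Fin m → ℝ) : |c.value O θ| ≤ 1 := by
  refine (Complex.abs_re_le_norm _).trans (entry_norm_bound_of_unitary ?_ 0 0)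
  rw [Matrix.mem_unitaryGroup_iff', Matrix.star_eq_conjTranspose]
  have hU := mul_eq_one_comm.mp (c.unitary_unitary θ)
  refine conjTranspose_mul_mul_cancel (conjTranspose_mul_mul_cancel ?_ hO) (c.unitary_unitary θ)
  rwa [Matrix.conjTranspose_conjTranspose]

end PauliCircuit

/-! ### The parameter-shift rules -/

/-- In each parameter, `f` is a trigonometric polynomial of degree one. -/
def IsTrig {m : ℕ} (f : (Fin m → ℝ) → ℝ) : Prop :=
  ∀ (k : Fin m) (θ : Fin m → ℝ), ∃ a b c : ℝ,
    ∀ t, f (Function.update θ k t) = a + b * Real.cos t + c * Real.sin t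

section ParameterShift

variable {m : ℕ} {f g : (Fin m → ℝ) → ℝ}

theorem update_self_add (θ : Fin m → ℝ) (k : Fin m) (s : ℝ) :
    θ + Pi.single k s = Function.update θ k (θ k + s) := by
  ext i
  by_cases h : i = k
  · subst h; simp
  · simp [h]

theorem update_add (θ s : Fin m → ℝ) (k : Fin m) (t : ℝ) :
    Function.update θ k t + s = Function.update (θ + s) k (t + s k) := by
  ext i
  by_cases h : i = k
  · subst h; simp
  · simp [h]

theorem IsTrig.partialDeriv_eq (hf : IsTrig f) (k : Fin m) (θ : Fin m → ℝ) :
    partialDeriv k f θ = 1 / 2 * f (θ + Pi.single k (Real.pi / 2)) -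
      1 / 2 * f (θ + Pi.single k (-Real.pi / 2)) := by
  obtain ⟨a, b, c, h⟩ := hf k θ
  rw [update_self_add, update_self_add, h, h, partialDeriv]
  simp only [h]
  have hd : HasDerivAt (fun t => a + b * Real.cos t + c * Real.sin t)
      (b * -Real.sin (θ k) + c * Real.cos (θ k)) (θ k) :=
    (((Real.hasDerivAt_cos _).const_mul b).const_add a).add ((Real.hasDerivAt_sin _).const_mul c)
  rw [hd.deriv, neg_div, ← sub_eq_add_neg, Real.cos_add_pi_div_two, Real.sin_add_pi_div_two,
    Real.cos_sub_pi_div_two, Real.sin_sub_pi_div_two]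
  ring

theorem IsTrig.translate (hf : IsTrig f) (s : Fin m → ℝ) : IsTrig fun θ => f (θ + s) := by
  intro k θ
  obtain ⟨a, b, c, h⟩ := hf k (θ + s)
  refine ⟨a, b * Real.cos (s k) + c * Real.sin (s k),
    -b * Real.sin (s k) + c * Real.cos (s k), fun t => ?_⟩
  beta_reduce
  rw [update_add, h, Real.cos_add, Real.sin_add]
  ring

/-- By the shift rule the derivative is a combination of translates, so it stays in the class and
the rule can be iterated for Hessians. -/
theorem IsTrig.partialDeriv (hf : IsTrig f) (k : Fin m) : IsTrig (partialDeriv k f) := by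
  intro l θ
  obtain ⟨a, b, c, h⟩ := hf.translate (Pi.single k (Real.pi / 2)) l θ
  obtain ⟨a', b', c', h'⟩ := hf.translate (Pi.single k (-Real.pi / 2)) l θ
  refine ⟨1 / 2 * a - 1 / 2 * a', 1 / 2 * b - 1 / 2 * b', 1 / 2 * c - 1 / 2 * c', fun t => ?_⟩
  beta_reduce at h h'
  rw [hf.partialDeriv_eq, h, h']
  ring

section StencilSums

variable {E : Type*} [AddCommMonoid E] (Φ : ℝ → (Fin m → ℝ) → E)

theorem sum_stencil_gradient (k : Fin m) :
    ∑ a, Φ ((Component.gradient k).stencil.weight a) ((Component.gradient k).stencil.shift a) =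
      Φ (1 / 2) (Pi.single k (Real.pi / 2)) + Φ (-1 / 2) (Pi.single k (-Real.pi / 2)) :=
  Fin.sum_univ_two _

theorem sum_stencil_diagHessian (k : Fin m) :
    ∑ a, Φ ((Component.diagHessian k).stencil.weight a)
        ((Component.diagHessian k).stencil.shift a) =
      Φ (1 / 4) (Pi.single k Real.pi) + Φ (-1 / 2) 0 + Φ (1 / 4) (Pi.single k (-Real.pi)) :=
  Fin.sum_univ_three _

theorem sum_stencil_offDiagHessian (k l : Fin m) (h : k ≠ l) :
    ∑ a, Φ ((Component.offDiagHessian k l h).stencil.weight a)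
        ((Component.offDiagHessian k l h).stencil.shift a) =
      Φ (1 / 4) (Pi.single k (Real.pi / 2) + Pi.single l (Real.pi / 2)) +
        Φ (-1 / 4) (Pi.single k (Real.pi / 2) + Pi.single l (-Real.pi / 2)) +
        Φ (-1 / 4) (Pi.single k (-Real.pi / 2) + Pi.single l (Real.pi / 2)) +
        Φ (1 / 4) (Pi.single k (-Real.pi / 2) + Pi.single l (-Real.pi / 2)) :=
  Fin.sum_univ_four _

end StencilSums

/-- The parameter-shift rules are exact. -/
theorem IsTrig.trueValue_eq (hf : IsTrig f) (comp : Component m) (θ : Fin m → ℝ) :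
    comp.trueValue f θ = ∑ a, comp.stencil.weight a * f (θ + comp.stencil.shift a) := by
  cases comp with
  | gradient k =>
    rw [sum_stencil_gradient fun w s => w * f (θ + s), Component.trueValue, hf.partialDeriv_eq]
    ring
  | diagHessian k =>
    rw [sum_stencil_diagHessian fun w s => w * f (θ + s), Component.trueValue,
      (hf.partialDeriv k).partialDeriv_eq, hf.partialDeriv_eq, hf.partialDeriv_eq]
    -- The two mixed shifts add up to zero and merge into the centre point of weight -1/2.
    simp only [add_assoc, ← Pi.single_add]
    have e1 : Real.pi / 2 + Real.pi / 2 = Real.pi := by ring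
    have e2 : Real.pi / 2 + -Real.pi / 2 = 0 := by ring
    have e3 : -Real.pi / 2 + Real.pi / 2 = 0 := by ring
    have e4 : -Real.pi / 2 + -Real.pi / 2 = -Real.pi := by ring
    rw [e1, e2, e3, e4, Pi.single_zero]
    ring
  | offDiagHessian k l h =>
    rw [sum_stencil_offDiagHessian fun w s => w * f (θ + s), Component.trueValue,
      (hf.partialDeriv l).partialDeriv_eq, hf.partialDeriv_eq, hf.partialDeriv_eq]
    simp only [add_assoc]
    ring

end ParameterShift

/-- Only gate k contains θ_k, and conjugation by it has coefficients cos²(t/2), sin²(t/2) and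
cos(t/2)sin(t/2), which are combinations of 1, cos t and sin t. -/
theorem PauliCircuit.isTrig_value {n m : ℕ} (c : PauliCircuit n m) (O : Op n) :
    IsTrig (c.value O) := by
  intro k θ
  set A := c.segment θ (k.val + 1) (m - (k.val + 1)) with hA
  set V := c.segment θ 0 k.val with hV
  have hu : ∀ t, c.unitary (Function.update θ k t) = A * pauliRotation (c.pauli k) t * V := by
    intro t
    rw [c.unitary_eq _ k, Function.update_self, hA, hV]
    congr 1
    · congr 1
      refine c.segment_congr fun i h1 h2 => Function.update_of_ne ?_ _ _
      rintro rfl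
      omega
    · refine c.segment_congr fun i h1 h2 => Function.update_of_ne ?_ _ _
      rintro rfl
      omega
  have hv : ∀ t, c.value O (Function.update θ k t) =
      ((Vᴴ * ((pauliRotation (c.pauli k) t)ᴴ * (Aᴴ * O * A) * pauliRotation (c.pauli k) t) * V)
        0 0).re := by
    intro t
    rw [value, hu]
    simp only [Matrix.conjTranspose_mul, mul_assoc]
  set B := Aᴴ * O * A
  set P := c.pauli k
  refine ⟨((Vᴴ * B * V) 0 0).re / 2 + ((Vᴴ * (P * B * P) * V) 0 0).re / 2,
    ((Vᴴ * B * V) 0 0).re / 2 - ((Vᴴ * (P * B * P) * V) 0 0).re / 2,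
    -((Vᴴ * (P * B - B * P) * V) 0 0).im / 2, fun t => ?_⟩
  rw [hv, pauliRotation_conj (c.pauli_conjTranspose k)]
  simp only [mul_add, add_mul, mul_smul_comm, smul_mul_assoc, Matrix.add_apply, Matrix.smul_apply]
  generalize (Vᴴ * B * V) 0 0 = x
  generalize (Vᴴ * (P * B * P) * V) 0 0 = y
  generalize (Vᴴ * (P * B - B * P) * V) 0 0 = z
  have e1 : ((Real.cos (t / 2) : ℂ) ^ 2) = ((Real.cos (t / 2) ^ 2 : ℝ) : ℂ) := by push_cast; rfl
  have e2 : ((Real.sin (t / 2) : ℂ) ^ 2) = ((Real.sin (t / 2) ^ 2 : ℝ) : ℂ) := by push_cast; rfl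
  have e3 : Complex.I * (Real.cos (t / 2) : ℂ) * (Real.sin (t / 2) : ℂ) =
      ((Real.cos (t / 2) * Real.sin (t / 2) : ℝ) : ℂ) * Complex.I := by push_cast; ring
  rw [e1, e2, e3]
  simp only [smul_eq_mul, Complex.add_re, Complex.re_ofReal_mul, mul_assoc, Complex.I_mul_re]
  have hc : Real.cos t = 2 * Real.cos (t / 2) ^ 2 - 1 := by rw [← Real.cos_two_mul]; ring_nf
  have hs : Real.sin t = 2 * Real.sin (t / 2) * Real.cos (t / 2) := by
    rw [← Real.sin_two_mul]; ring_nf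
  rw [hc, hs, Real.sin_sq]
  ring

/-! ### Uncorrelated parts of a circuit -/

section Cut

variable {n m : ℕ} {μ : Measure (Fin m → ℝ)}

/-- Extension of a family of parameters by zero. -/
noncomputable def extendZero (p : Fin m → Prop) [DecidablePred p] (x : {i : Fin m // p i} → ℝ) :
    Fin m → ℝ := fun i => if h : p i then x ⟨i, h⟩ else 0

theorem continuous_extendZero (p : Fin m → Prop) [DecidablePred p] :
    Continuous (extendZero p) := by
  refine continuous_pi fun i => ?_
  unfold extendZero
  split_ifs with h
  · exact continuous_apply _
  · exact continuous_const

/-- Independence concerns subfamilies of parameters, while V and B take all of them. Extending a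
subfamily by zero does not change the values, because of the `DependsOn` hypotheses, and shows that
V and B factor through the subfamilies. -/
theorem CutIndep.decoupled {t : ℕ} (hμ : CutIndep μ t) {V B : (Fin m → ℝ) → Op n}
    (hV : Continuous V) (hB : Continuous B) (hVt : DependsOn V {i | i.val < t})
    (hBt : DependsOn B {i | t ≤ i.val}) : Decoupled μ V B := by
  intro F G hF hG
  have e1 : (fun θ => F (V θ)) = (fun x => F (V (extendZero (fun i : Fin m => i.val < t) x))) ∘
      fun (θ : Fin m → ℝ) (i : {i : Fin m // i.val < t}) => θ i := by
    ext θ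
    refine congrArg F (hVt fun i hi => ?_)
    have hi' : i.val < t := hi
    simp [extendZero, hi']
  have e2 : (fun θ => G (B θ)) = (fun x => G (B (extendZero (fun i : Fin m => t ≤ i.val) x))) ∘
      fun (θ : Fin m → ℝ) (i : {i : Fin m // t ≤ i.val}) => θ i := by
    ext θ
    refine congrArg G (hBt fun i hi => ?_)
    have hi' : t ≤ i.val := hi
    simp [extendZero, hi']
  have h := IndepFun.comp hμ
    (hF.comp (hV.comp (continuous_extendZero fun i : Fin m => i.val < t))).measurable
    (hG.comp (hB.comp (continuous_extendZero fun i : Fin m => t ≤ i.val))).measurable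
  have h' : IndepFun (fun θ => F (V θ)) (fun θ => G (B θ)) μ := by
    rw [e1, e2]
    exact h
  exact h'.integral_fun_mul_eq_mul_integral
    (hF.comp hV).aestronglyMeasurable (hG.comp hB).aestronglyMeasurable

theorem bddOp_of_unitary [IsProbabilityMeasure μ] {V : (Fin m → ℝ) → Op n} (hV : Continuous V)
    (hU : ∀ θ, (V θ)ᴴ * V θ = 1) : BddOp μ V := fun i j =>
  memLp_top_of_bound (hV.matrix_elem i j).aestronglyMeasurable 1 <| Filter.Eventually.of_forall
    fun θ => entry_norm_bound_of_unitary (Matrix.mem_unitaryGroup_iff'.mpr (hU θ)) i j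

end Cut

/-! ### Moments of the circuit function and of its components -/

namespace PauliCircuit

variable {n m : ℕ} (c : PauliCircuit n m)

/-- The observable `O` in the Heisenberg picture of the operations after the encoded gate `k`. -/
noncomputable def afterGate (O : Op n) (k : Fin m) (θ : Fin m → ℝ) : Op n :=
  (c.segment θ (k.val + 1) (m - (k.val + 1)))ᴴ * O * c.segment θ (k.val + 1) (m - (k.val + 1))

theorem afterGate_def (O : Op n) (k : Fin m) (θ : Fin m → ℝ) : c.afterGate O k θ =
    (c.segment θ (k.val + 1) (m - (k.val + 1)))ᴴ * O * c.segment θ (k.val + 1) (m - (k.val + 1)) :=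
  rfl

theorem heisenberg_eq (O : Op n) (k : Fin m) (θ : Fin m → ℝ) :
    c.heisenberg O k θ = (pauliRotation (c.pauli k) (θ k))ᴴ * c.afterGate O k θ *
      pauliRotation (c.pauli k) (θ k) := rfl

theorem rotation_unitary (k : Fin m) (t : ℝ) :
    (pauliRotation (c.pauli k) t)ᴴ * pauliRotation (c.pauli k) t = 1 :=
  pauliRotation_unitary (c.pauli_conjTranspose k) (c.pauli_mul_self k) t

theorem continuous_rotation (k : Fin m) (s : ℝ) :
    Continuous fun θ : Fin m → ℝ => pauliRotation (c.pauli k) (θ k + s) := by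
  unfold pauliRotation
  fun_prop

theorem trace_afterGate (O : Op n) (k : Fin m) (θ : Fin m → ℝ) :
    (c.afterGate O k θ).trace = O.trace := trace_conj_eq (c.segment_unitary _ _ _) _

theorem trace_heisenberg (O : Op n) (k : Fin m) (θ : Fin m → ℝ) :
    (c.heisenberg O k θ).trace = O.trace := by
  rw [heisenberg_eq, trace_conj_eq (c.rotation_unitary _ _), trace_afterGate]

theorem trace_afterGate_sq (O : Op n) (k : Fin m) (θ : Fin m → ℝ) :
    (c.afterGate O k θ * c.afterGate O k θ).trace = (O * O).trace :=
  trace_conj_sq_eq (c.segment_unitary _ _ _) _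

theorem trace_heisenberg_sq (O : Op n) (k : Fin m) (θ : Fin m → ℝ) :
    (c.heisenberg O k θ * c.heisenberg O k θ).trace = (O * O).trace := by
  rw [heisenberg_eq, trace_conj_sq_eq (c.rotation_unitary _ _), trace_afterGate_sq]

theorem continuous_afterGate (O : Op n) (k : Fin m) : Continuous (c.afterGate O k) :=
  ((c.continuous_segment _ _).matrix_conjTranspose.mul continuous_const).mul
    (c.continuous_segment _ _)

theorem continuous_heisenberg (O : Op n) (k : Fin m) : Continuous (c.heisenberg O k) := by
  have h := c.continuous_rotation k 0
  simp only [add_zero] at h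
  exact (h.matrix_conjTranspose.mul (c.continuous_afterGate O k)).mul h

theorem dependsOn_afterGate (O : Op n) (k : Fin m) :
    DependsOn (c.afterGate O k) {i | k.val + 1 ≤ i.val} := by
  intro θ θ' h
  rw [afterGate, afterGate, c.segment_congr fun i h1 _ => h i h1]

theorem dependsOn_heisenberg (O : Op n) (k : Fin m) :
    DependsOn (c.heisenberg O k) {i | k.val ≤ i.val} := by
  intro θ θ' h
  rw [heisenberg_eq, heisenberg_eq,
    c.dependsOn_afterGate O k fun i hi => h i (Nat.le_of_succ_le hi), h k (Set.mem_ofPred.mpr le_rfl)]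

theorem dependsOn_segment (a len t : ℕ) (h : a + len ≤ t) :
    DependsOn (fun θ => c.segment θ a len) {i | i.val < t} := by
  intro θ θ' hθ
  exact c.segment_congr fun i _ h2 => hθ i (Set.mem_ofPred.mpr (by omega))

/-- The random pure state before the encoded gate `k`. -/
noncomputable def stateBefore (k : Fin m) (θ : Fin m → ℝ) : Op n :=
  c.segment θ 0 k.val * Matrix.single 0 0 1 * (c.segment θ 0 k.val)ᴴ

theorem stateBefore_eq (k : Fin m) (θ : Fin m → ℝ) : c.stateBefore k θ =
    c.segment θ 0 k.val * Matrix.single 0 0 1 * (c.segment θ 0 k.val)ᴴ := rfl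

/-- A shift that spares the parameters before k changes only the observable, not the random state.
Thus averages of shifted values need no translation invariance of the law. -/
theorem value_shift_eq {O : Op n} (hO : Oᴴ = O) (k : Fin m) {s : Fin m → ℝ}
    (hs : ∀ i, i < k → s i = 0) (θ : Fin m → ℝ) :
    (c.value O (θ + s) : ℂ) = (c.stateBefore k θ * c.heisenberg O k (θ + s)).trace := by
  rw [c.value_eq_heisenberg hO k, stateBefore, c.segment_congr (θ := θ + s) (θ' := θ)]
  intro i _ h
  have : s i = 0 := hs i (by rw [Fin.lt_def]; omega)
  simp [this]

theorem dependsOn_heisenberg_shift (O : Op n) (k : Fin m) (s : Fin m → ℝ) :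
    DependsOn (fun θ => c.heisenberg O k (θ + s)) {i | k.val ≤ i.val} := fun θ θ' h =>
  c.dependsOn_heisenberg O k fun i hi => by simp [h i hi]

theorem continuous_heisenberg_shift (O : Op n) (k : Fin m) (s : Fin m → ℝ) :
    Continuous fun θ => c.heisenberg O k (θ + s) :=
  (c.continuous_heisenberg O k).comp (continuous_id.add continuous_const)

/-- The Heisenberg-picture observable of which a component is the mean value. -/
noncomputable def stencilObservable (O : Op n) (k : Fin m) (comp : Component m)
    (θ : Fin m → ℝ) : Op n :=
  ∑ a, (comp.stencil.weight a : ℂ) • c.heisenberg O k (θ + comp.stencil.shift a)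

theorem heisenberg_shift_self (O : Op n) (k : Fin m) (θ : Fin m → ℝ) (t : ℝ) :
    c.heisenberg O k (θ + Pi.single k t) = (pauliRotation (c.pauli k) (θ k + t))ᴴ *
      c.afterGate O k θ * pauliRotation (c.pauli k) (θ k + t) := by
  rw [heisenberg_eq, c.dependsOn_afterGate O k (y := θ)]
  · simp
  · intro i hi
    have : i ≠ k := by
      rintro rfl
      exact absurd (Set.mem_ofPred.mp hi) (by omega)
    simp [this]

theorem stencilObservable_gradient (O : Op n) (k : Fin m) (θ : Fin m → ℝ) :
    c.stencilObservable O k (.gradient k) θ =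
      shiftDiff (c.pauli k) (c.afterGate O k θ) (θ k) := by
  rw [stencilObservable,
    sum_stencil_gradient fun w s => (w : ℂ) • c.heisenberg O k (θ + s)]
  simp only [heisenberg_shift_self, shiftDiff]
  push_cast
  module

theorem stencilObservable_diagHessian (O : Op n) (k : Fin m) (θ : Fin m → ℝ) :
    c.stencilObservable O k (.diagHessian k) θ =
      shiftDiff₂ (c.pauli k) (c.afterGate O k θ) (θ k) := by
  rw [stencilObservable,
    sum_stencil_diagHessian fun w s => (w : ℂ) • c.heisenberg O k (θ + s)]
  simp only [heisenberg_shift_self, shiftDiff₂, add_zero]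
  rw [heisenberg_eq]
  push_cast
  module

theorem afterGate_eq (O : Op n) {k l : Fin m} (h : k < l) (θ : Fin m → ℝ) :
    c.afterGate O k θ = (c.segment θ (k.val + 1) (l.val - (k.val + 1)))ᴴ * c.heisenberg O l θ *
      c.segment θ (k.val + 1) (l.val - (k.val + 1)) := by
  have hkl : k.val < l.val := h
  have hl := l.isLt
  rw [afterGate, c.segment_eq_of_mem θ l (by omega) (by omega), heisenberg]
  have e : k.val + 1 + (m - (k.val + 1)) - (l.val + 1) = m - (l.val + 1) := by omega
  rw [e]
  simp only [Matrix.conjTranspose_mul, mul_assoc]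

/-- The derivative with respect to parameter `l`, after the encoded gate `k`. -/
noncomputable def innerObservable (O : Op n) (k l : Fin m) (θ : Fin m → ℝ) : Op n :=
  (c.segment θ (k.val + 1) (l.val - (k.val + 1)))ᴴ *
    shiftDiff (c.pauli l) (c.afterGate O l θ) (θ l) *
    c.segment θ (k.val + 1) (l.val - (k.val + 1))

theorem innerObservable_eq (O : Op n) (k l : Fin m) (θ : Fin m → ℝ) : c.innerObservable O k l θ =
    (c.segment θ (k.val + 1) (l.val - (k.val + 1)))ᴴ *
      shiftDiff (c.pauli l) (c.afterGate O l θ) (θ l) *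
      c.segment θ (k.val + 1) (l.val - (k.val + 1)) := rfl

theorem heisenberg_shift_pair (O : Op n) {k l : Fin m} (h : k < l) (θ : Fin m → ℝ) (s t : ℝ) :
    c.heisenberg O k (θ + (Pi.single k s + Pi.single l t)) =
      (pauliRotation (c.pauli k) (θ k + s))ᴴ *
        ((c.segment θ (k.val + 1) (l.val - (k.val + 1)))ᴴ *
          ((pauliRotation (c.pauli l) (θ l + t))ᴴ * c.afterGate O l θ *
            pauliRotation (c.pauli l) (θ l + t)) *
          c.segment θ (k.val + 1) (l.val - (k.val + 1))) *
        pauliRotation (c.pauli k) (θ k + s) := by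
  have hkl : k.val < l.val := h
  rw [add_comm (Pi.single k s : Fin m → ℝ), ← add_assoc, heisenberg_shift_self, afterGate_eq c O h,
    heisenberg_shift_self, Pi.add_apply, Pi.single_eq_of_ne h.ne, add_zero,
    c.segment_congr (θ := θ + (Pi.single l t : Fin m → ℝ)) (θ' := θ)]
  intro i _ hi
  have : i ≠ l := by
    rintro rfl
    omega
  simp [this]

/-- The four-point stencil is a product of two-point stencils: the difference at the later gate l
sits inside the one at gate k. -/
theorem sum_heisenberg_pair (O : Op n) {k l : Fin m} (h : k < l) (θ : Fin m → ℝ) :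
    (1 / 4 : ℂ) • c.heisenberg O k
        (θ + (Pi.single k (Real.pi / 2) + Pi.single l (Real.pi / 2))) +
      (-1 / 4 : ℂ) • c.heisenberg O k
        (θ + (Pi.single k (Real.pi / 2) + Pi.single l (-Real.pi / 2))) +
      (-1 / 4 : ℂ) • c.heisenberg O k
        (θ + (Pi.single k (-Real.pi / 2) + Pi.single l (Real.pi / 2))) +
      (1 / 4 : ℂ) • c.heisenberg O k
        (θ + (Pi.single k (-Real.pi / 2) + Pi.single l (-Real.pi / 2))) =
      shiftDiff (c.pauli k) (c.innerObservable O k l θ) (θ k) := by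
  simp only [c.heisenberg_shift_pair O h, innerObservable]
  generalize c.segment θ (k.val + 1) (l.val - (k.val + 1)) = W
  generalize c.afterGate O l θ = A
  simp only [shiftDiff, mul_sub, sub_mul, mul_smul_comm, smul_mul_assoc, smul_sub, smul_smul]
  module

theorem stencilObservable_offDiagHessian (O : Op n) (k l : Fin m) (h : k ≠ l) (θ : Fin m → ℝ) :
    c.stencilObservable O (min k l) (.offDiagHessian k l h) θ =
      shiftDiff (c.pauli (min k l)) (c.innerObservable O (min k l) (max k l) θ)
        (θ (min k l)) := by
  rw [stencilObservable,
    sum_stencil_offDiagHessian fun w s => (w : ℂ) • c.heisenberg O (min k l) (θ + s)]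
  rcases lt_or_gt_of_ne h with hkl | hkl
  · rw [min_eq_left hkl.le, max_eq_right hkl.le, ← c.sum_heisenberg_pair O hkl]
    push_cast
    rfl
  · rw [min_eq_right hkl.le, max_eq_left hkl.le, ← c.sum_heisenberg_pair O hkl]
    -- Exchanging k and l only permutes the two terms of weight -1/4.
    simp only [add_comm (Pi.single k _ : Fin m → ℝ) (Pi.single l _)]
    push_cast
    module

theorem continuous_smul_op {A : (Fin m → ℝ) → Op n} (hA : Continuous A) (r : ℂ) :
    Continuous fun θ => r • A θ := hA.const_smul r

theorem continuous_shiftDiff {A : (Fin m → ℝ) → Op n} (hA : Continuous A) (k : Fin m) :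
    Continuous fun θ => shiftDiff (c.pauli k) (A θ) (θ k) := by
  unfold shiftDiff
  have h1 := c.continuous_rotation k (Real.pi / 2)
  have h2 := c.continuous_rotation k (-Real.pi / 2)
  exact (continuous_smul_op ((h1.matrix_conjTranspose.mul hA).mul h1) _).sub
    (continuous_smul_op ((h2.matrix_conjTranspose.mul hA).mul h2) _)

variable {μ : Measure (Fin m → ℝ)}

theorem decoupled_before {k : Fin m} (hc : CutIndep μ k.val) {B : (Fin m → ℝ) → Op n}
    (hB : Continuous B) (hBk : DependsOn B {i | k.val ≤ i.val}) :
    Decoupled μ (fun θ => c.segment θ 0 k.val) B :=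
  hc.decoupled (c.continuous_segment _ _) hB (c.dependsOn_segment 0 k.val k.val (by simp)) hBk

variable [IsProbabilityMeasure μ]

theorem bddOp_segment (a len : ℕ) : BddOp μ fun θ => c.segment θ a len :=
  bddOp_of_unitary (c.continuous_segment a len) fun θ => c.segment_unitary θ a len

theorem bddOp_afterGate (O : Op n) (k : Fin m) : BddOp μ (c.afterGate O k) :=
  ((c.bddOp_segment _ _).conjTranspose.mul (BddOp.const O)).mul (c.bddOp_segment _ _)

theorem bddOp_rotation (k : Fin m) (s : ℝ) :
    BddOp μ fun θ => pauliRotation (c.pauli k) (θ k + s) :=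
  bddOp_of_unitary (c.continuous_rotation k s) fun _ => c.rotation_unitary k _

theorem bddOp_heisenberg_shift (O : Op n) (k : Fin m) (s : Fin m → ℝ) :
    BddOp μ fun θ => c.heisenberg O k (θ + s) := by
  have h1 : BddOp μ fun θ => c.segment (θ + s) (k.val + 1) (m - (k.val + 1)) :=
    bddOp_of_unitary ((c.continuous_segment _ _).comp (continuous_id.add continuous_const))
      fun _ => c.segment_unitary _ _ _
  exact ((c.bddOp_rotation k (s k)).conjTranspose.mul
    ((h1.conjTranspose.mul (BddOp.const O)).mul h1)).mul (c.bddOp_rotation k (s k))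

theorem bddOp_shiftDiff {A : (Fin m → ℝ) → Op n} (hA : BddOp μ A) (k : Fin m) :
    BddOp μ fun θ => shiftDiff (c.pauli k) (A θ) (θ k) := by
  simp only [shiftDiff, sub_eq_add_neg, ← neg_smul]
  exact ((((c.bddOp_rotation k _).conjTranspose.mul hA).mul (c.bddOp_rotation k _)).smul _).add
    ((((c.bddOp_rotation k _).conjTranspose.mul hA).mul (c.bddOp_rotation k _)).smul _)

variable [Nontrivial (Qubits n)]

theorem integral_value_shift {O : Op n} (hO : Oᴴ = O) (hO0 : O.trace = 0) {k : Fin m}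
    (hc : CutIndep μ k.val) (hV : IsTwoDesign μ fun θ => c.segment θ 0 k.val) {s : Fin m → ℝ}
    (hs : ∀ i, i < k → s i = 0) : ∫ θ, c.value O (θ + s) ∂μ = 0 := by
  have h := hV.integral_trace_of_pure (c.bddOp_segment _ _) (fun θ => c.segment_unitary θ _ _)
    (c.bddOp_heisenberg_shift O k s)
    (c.decoupled_before hc (c.continuous_heisenberg_shift O k s) (c.dependsOn_heisenberg_shift O k s))
    (fun θ => (c.trace_heisenberg O k _).trans hO0) 0
  simp only [← stateBefore_eq, ← c.value_shift_eq hO k hs] at h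
  rw [integral_complex_ofReal] at h
  exact_mod_cast h

theorem integral_value_shift_sq {O : Op n} (hO : Oᴴ = O) (hOO : O * O = 1) (hO0 : O.trace = 0)
    {k : Fin m} (hc : CutIndep μ k.val) (hV : IsTwoDesign μ fun θ => c.segment θ 0 k.val)
    {s : Fin m → ℝ} (hs : ∀ i, i < k → s i = 0) :
    ∫ θ, c.value O (θ + s) ^ 2 ∂μ = 1 / (2 ^ n + 1) := by
  have h := hV.integral_trace_sq_of_pure (c.bddOp_segment _ _)
    (fun θ => c.segment_unitary θ _ _) (c.bddOp_heisenberg_shift O k s)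
    (c.decoupled_before hc (c.continuous_heisenberg_shift O k s)
      (c.dependsOn_heisenberg_shift O k s)) 0
  simp only [← stateBefore_eq, ← c.value_shift_eq hO k hs, trace_heisenberg, trace_heisenberg_sq,
    hO0, hOO, trace_one_qubits, integral_const, probReal_univ, one_smul] at h
  have h2 : (1 : ℂ) / (2 ^ n + 1) = (0 ^ 2 + 2 ^ n) / (2 ^ n * (2 ^ n + 1)) := by
    obtain ⟨h0, -, h1⟩ := two_pow_algebra_ne_zero (n := n)
    field_simp
    ring
  rw [← h2] at h
  simp only [← Complex.ofReal_pow] at h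
  rw [integral_complex_ofReal] at h
  apply Complex.ofReal_injective
  rw [h]
  push_cast
  rfl

/-- By linearity the stencil sum is the mean of one traceless observable in the random pure state,
so only its trace of the square contributes. -/
theorem integral_stencil_sq {O : Op n} (hO : Oᴴ = O) (hO0 : O.trace = 0) {k : Fin m}
    (hc : CutIndep μ k.val) (hV : IsTwoDesign μ fun θ => c.segment θ 0 k.val)
    (comp : Component m) (hs : ∀ a i, i < k → comp.stencil.shift a i = 0) :
    ((∫ θ, (∑ a, comp.stencil.weight a * c.value O (θ + comp.stencil.shift a)) ^ 2 ∂μ : ℝ) : ℂ) =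
      (∫ θ, (c.stencilObservable O k comp θ * c.stencilObservable O k comp θ).trace ∂μ) /
        (2 ^ n * (2 ^ n + 1)) := by
  have hcont : Continuous (c.stencilObservable O k comp) :=
    continuous_finsetSum _ fun a _ =>
      continuous_smul_op (c.continuous_heisenberg_shift O k _) _
  have hdep : DependsOn (c.stencilObservable O k comp) {i | k.val ≤ i.val} := fun θ θ' h =>
    Finset.sum_congr rfl fun a _ => congrArg _ (c.dependsOn_heisenberg_shift O k _ h)
  have hb : BddOp μ (c.stencilObservable O k comp) :=
    BddOp.sum _ fun a => (c.bddOp_heisenberg_shift O k _).smul _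
  have htr : ∀ θ, (c.stencilObservable O k comp θ).trace = 0 := fun θ => by
    simp [stencilObservable, Matrix.trace_sum, trace_heisenberg, hO0]
  have h := hV.integral_trace_sq_of_pure (c.bddOp_segment _ _)
    (fun θ => c.segment_unitary θ _ _) hb (c.decoupled_before hc hcont hdep) 0
  simp only [htr, ne_eq, OfNat.ofNat_ne_zero, not_false_eq_true, zero_pow, integral_zero,
    zero_add, ← stateBefore_eq] at h
  rw [← h, ← integral_complex_ofReal]
  congr 1
  ext θ
  simp only [stencilObservable, Matrix.mul_sum, Matrix.trace_sum, mul_smul_comm,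
    Matrix.trace_smul, ← c.value_shift_eq hO k (hs _), smul_eq_mul]
  push_cast
  rfl

/-- Here tr A² = d and tr PAPA averages to -d/(d²-1); half the difference is d³/(2(d²-1)). -/
theorem integral_commutator {O : Op n} (hOO : O * O = 1) (hO0 : O.trace = 0) {k : Fin m}
    (hV : IsTwoDesign μ fun θ => c.segment θ (k.val + 1) (m - (k.val + 1))) :
    ∫ θ, ((c.afterGate O k θ * c.afterGate O k θ).trace -
      (c.pauli k * c.afterGate O k θ * (c.pauli k * c.afterGate O k θ)).trace) / 2 ∂μ =
      (2 ^ n) ^ 3 / (2 * ((2 ^ n) ^ 2 - 1)) := by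
  have h := hV.integral_trace_otoc (c.bddOp_segment _ _) (fun θ => c.segment_unitary θ _ _)
    (BddOp.const O) (Decoupled.const _ O) (fun _ => hO0) (c.pauli_trace k) (c.pauli_mul_self k)
  have hi : Integrable (fun θ =>
      (c.pauli k * c.afterGate O k θ * (c.pauli k * c.afterGate O k θ)).trace) μ := by
    have hb : BddOp μ fun θ => c.pauli k * c.afterGate O k θ :=
      (BddOp.const _).mul (c.bddOp_afterGate O k)
    exact (hb.mul hb).trace.integrable le_top
  rw [integral_div, integral_sub _ hi]
  · simp only [trace_afterGate_sq, hOO, trace_one_qubits, integral_const, probReal_univ,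
      one_smul] at h ⊢
    simp only [← afterGate_def] at h
    rw [h]
    obtain ⟨h0, h1, h2⟩ := two_pow_algebra_ne_zero (n := n)
    have hne := two_pow_sq_sub_one_ne_zero (n := n)
    field_simp
    ring
  · exact ((c.bddOp_afterGate O k).mul (c.bddOp_afterGate O k)).trace.integrable le_top

/-- The commutator argument is applied twice: the traceless derivative at gate l plays the role of O
for gate k, twirled by the segment between the gates. Each gate gives a factor d²/(2(d²-1)). -/
theorem integral_commutator_pair {O : Op n} (hOO : O * O = 1) (hO0 : O.trace = 0) {k l : Fin m}
    (hkl : k < l) (hc : CutIndep μ l.val)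
    (hV : IsTwoDesign μ fun θ => c.segment θ (l.val + 1) (m - (l.val + 1)))
    (hW : IsTwoDesign μ fun θ => c.segment θ (k.val + 1) (l.val - (k.val + 1))) :
    ∫ θ, (shiftDiff (c.pauli k) (c.innerObservable O k l θ) (θ k) *
      shiftDiff (c.pauli k) (c.innerObservable O k l θ) (θ k)).trace ∂μ =
      (2 ^ n) ^ 5 / (4 * ((2 ^ n) ^ 2 - 1) ^ 2) := by
  have hP := c.pauli_conjTranspose
  have hPP := c.pauli_mul_self
  have hkl' : k.val < l.val := hkl
  have hbB : BddOp μ fun θ => shiftDiff (c.pauli l) (c.afterGate O l θ) (θ l) :=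
    c.bddOp_shiftDiff (c.bddOp_afterGate O l) l
  have hd : Decoupled μ (fun θ => c.segment θ (k.val + 1) (l.val - (k.val + 1)))
      fun θ => shiftDiff (c.pauli l) (c.afterGate O l θ) (θ l) := by
    refine hc.decoupled (c.continuous_segment _ _)
      (c.continuous_shiftDiff (c.continuous_afterGate O l) l)
      (c.dependsOn_segment _ _ _ (by omega)) fun θ θ' h => ?_
    rw [c.dependsOn_afterGate O l fun i hi => h i (Nat.le_of_succ_le hi),
      h l (Set.mem_ofPred.mpr le_rfl)]
  have h := hW.integral_trace_otoc (c.bddOp_segment _ _) (fun θ => c.segment_unitary θ _ _) hbB hd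
    (fun θ => shiftDiff_trace (hP l) (hPP l) _ _) (c.pauli_trace k) (hPP k)
  simp only [← innerObservable_eq] at h
  have hbI : BddOp μ (c.innerObservable O k l) :=
    ((c.bddOp_segment _ _).conjTranspose.mul hbB).mul (c.bddOp_segment _ _)
  have hi : Integrable (fun θ =>
      (c.pauli k * c.innerObservable O k l θ * (c.pauli k * c.innerObservable O k l θ)).trace) μ := by
    have hb : BddOp μ fun θ => c.pauli k * c.innerObservable O k l θ := (BddOp.const _).mul hbI
    exact (hb.mul hb).trace.integrable le_top
  have hsq : ∀ θ, (c.innerObservable O k l θ * c.innerObservable O k l θ).trace =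
      (shiftDiff (c.pauli l) (c.afterGate O l θ) (θ l) *
        shiftDiff (c.pauli l) (c.afterGate O l θ) (θ l)).trace := fun θ =>
    trace_conj_sq_eq (c.segment_unitary _ _ _) _
  have hB2 : ∫ θ, (shiftDiff (c.pauli l) (c.afterGate O l θ) (θ l) *
      shiftDiff (c.pauli l) (c.afterGate O l θ) (θ l)).trace ∂μ =
      (2 ^ n) ^ 3 / (2 * ((2 ^ n) ^ 2 - 1)) := by
    simp only [shiftDiff_sq_trace (hP l) (hPP l)]
    exact c.integral_commutator hOO hO0 hV
  simp only [shiftDiff_sq_trace (hP k) (hPP k)]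
  rw [integral_div, integral_sub ((hbI.mul hbI).trace.integrable le_top) hi, h]
  simp only [hsq]
  rw [hB2]
  obtain ⟨h0, h1, h2⟩ := two_pow_algebra_ne_zero (n := n)
  have hne := two_pow_sq_sub_one_ne_zero (n := n)
  field_simp
  ring

end PauliCircuit

/-! ### The mean-squared error -/

namespace Component

variable {n m : ℕ}

/-- The encoded parameter of a component that acts first. -/
def first : Component m → Fin m
  | gradient k => k
  | diagHessian k => k
  | offDiagHessian k l _ => min k l

theorem shift_eq_zero (comp : Component m) (a : Fin comp.stencil.size) (i : Fin m)
    (hi : i < comp.first) : comp.stencil.shift a i = 0 := by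
  cases comp with
  | gradient k =>
    have hk : i ≠ k := hi.ne
    have : ∀ a : Fin 2, (![Pi.single k (Real.pi / 2), Pi.single k (-Real.pi / 2)] :
        Fin 2 → Fin m → ℝ) a i = 0 := by
      intro a
      fin_cases a <;> simp [hk]
    exact this a
  | diagHessian k =>
    have hk : i ≠ k := hi.ne
    have : ∀ a : Fin 3, (![Pi.single k Real.pi, 0, Pi.single k (-Real.pi)] :
        Fin 3 → Fin m → ℝ) a i = 0 := by
      intro a
      fin_cases a <;> simp [hk]
    exact this a
  | offDiagHessian k l h =>
    have hk : i ≠ k := (hi.trans_le (min_le_left k l)).ne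
    have hl : i ≠ l := (hi.trans_le (min_le_right k l)).ne
    have : ∀ a : Fin 4, (![Pi.single k (Real.pi / 2) + Pi.single l (Real.pi / 2),
        Pi.single k (Real.pi / 2) + Pi.single l (-Real.pi / 2),
        Pi.single k (-Real.pi / 2) + Pi.single l (Real.pi / 2),
        Pi.single k (-Real.pi / 2) + Pi.single l (-Real.pi / 2)] :
        Fin 4 → Fin m → ℝ) a i = 0 := by
      intro a
      fin_cases a <;> simp [hk, hl]
    exact this a

theorem sum_weight (comp : Component m) : ∑ a, comp.stencil.weight a = 0 := by
  cases comp with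
  | gradient k => rw [sum_stencil_gradient fun w _ => w]; norm_num
  | diagHessian k => rw [sum_stencil_diagHessian fun w _ => w]; norm_num
  | offDiagHessian k l h => rw [sum_stencil_offDiagHessian fun w _ => w]; norm_num

/-- The mean square of a component. -/
noncomputable def meanSquare (d : ℝ) : Kind → ℝ
  | .gradient => d ^ 2 / (2 * (d ^ 2 - 1) * (d + 1))
  | .diagHessian => d ^ 2 / (2 * (d ^ 2 - 1) * (d + 1))
  | .offDiagHessian => d ^ 4 / (4 * (d ^ 2 - 1) ^ 2 * (d + 1))

theorem meanSquare_pos {d : ℝ} (hd : 1 < d) (κ : Kind) : 0 < meanSquare d κ := by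
  have : 0 < d ^ 2 - 1 := by nlinarith
  cases κ <;> simp only [meanSquare] <;> positivity

theorem size_pos (comp : Component m) : 0 < (comp.stencil.size : ℝ) := by
  cases comp <;> simp [stencil]

/-- This identity explains `criticalPrefactor`: with total copy number N_T, the variance part of the
MSE is λ²·4pMq/N_T, whence the common form `quadraticError`. -/
theorem sum_weight_sq (comp : Component m) {d : ℝ} (hd : 1 < d) :
    (∑ a, comp.stencil.weight a ^ 2) * comp.stencil.size / (d + 1) =
      4 * criticalPrefactor d comp.kind * meanSquare d comp.kind := by
  have : 0 < d ^ 2 - 1 := by nlinarith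
  have h0 : 0 < d := by linarith
  cases comp with
  | gradient k =>
    rw [sum_stencil_gradient fun w _ => w ^ 2]
    simp only [kind, criticalPrefactor, meanSquare, stencil]
    push_cast
    field_simp
    norm_num
  | diagHessian k =>
    rw [sum_stencil_diagHessian fun w _ => w ^ 2]
    simp only [kind, criticalPrefactor, meanSquare, stencil]
    push_cast
    field_simp
    norm_num
  | offDiagHessian k l h =>
    rw [sum_stencil_offDiagHessian fun w _ => w ^ 2]
    simp only [kind, criticalPrefactor, meanSquare, stencil]
    push_cast
    field_simp
    norm_num

end Component

namespace PauliCircuit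

variable {n m : ℕ} (c : PauliCircuit n m) {μ : Measure (Fin m → ℝ)}

theorem TDS.cutIndep {comp : Component m} (h : c.TDS μ comp) : CutIndep μ comp.first.val := by
  cases comp with
  | gradient k => exact h.1
  | diagHessian k => exact h.1
  | offDiagHessian k l _ => exact h.1

theorem TDS.isTwoDesign {comp : Component m} (h : c.TDS μ comp) :
    IsTwoDesign μ fun θ => c.segment θ 0 comp.first.val := by
  cases comp with
  | gradient k => exact h.2.2.1
  | diagHessian k => exact h.2.2.1
  | offDiagHessian k l _ => exact h.2.2.2.2.1

/-- The mean square of a component under the two-design-sandwich condition. -/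
theorem integral_trueValue_sq [Nontrivial (Qubits n)] [IsProbabilityMeasure μ] {O : Op n}
    (hO : Oᴴ = O) (hOO : O * O = 1) (hO0 : O.trace = 0) {comp : Component m} (h : c.TDS μ comp) :
    ∫ θ, comp.trueValue (c.value O) θ ^ 2 ∂μ = Component.meanSquare (2 ^ n) comp.kind := by
  simp only [(c.isTrig_value O).trueValue_eq]
  have key := c.integral_stencil_sq hO hO0 h.cutIndep h.isTwoDesign comp comp.shift_eq_zero
  have hP := c.pauli_conjTranspose
  have hPP := c.pauli_mul_self
  obtain ⟨h0, h1, h2⟩ := two_pow_algebra_ne_zero (n := n)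
  have hne := two_pow_sq_sub_one_ne_zero (n := n)
  apply Complex.ofReal_injective
  rw [key]
  cases comp with
  | gradient k =>
    simp only [Component.first, stencilObservable_gradient, shiftDiff_sq_trace (hP k) (hPP k),
      Component.meanSquare, Component.kind]
    rw [c.integral_commutator hOO hO0 h.2.2.2]
    push_cast
    field_simp
  | diagHessian k =>
    simp only [Component.first, stencilObservable_diagHessian, shiftDiff₂_sq_trace (hP k) (hPP k),
      Component.meanSquare, Component.kind]
    rw [c.integral_commutator hOO hO0 h.2.2.2]
    push_cast
    field_simp
  | offDiagHessian k l hkl =>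
    simp only [Component.first, stencilObservable_offDiagHessian, Component.meanSquare,
      Component.kind]
    rw [c.integral_commutator_pair hOO hO0 (min_lt_max.mpr hkl) h.2.2.1 h.2.2.2.2.2.2
      h.2.2.2.2.2.1]
    push_cast
    field_simp

end PauliCircuit

/-! ### Born probabilities and the error of the schemes -/

section Born

variable {n : ℕ} {O : Op n} {B : Matrix.unitaryGroup (Qubits n) ℂ} {o : Qubits n → ℝ}

theorem unitaryGroup_conjTranspose_mul (B : Matrix.unitaryGroup (Qubits n) ℂ) :
    (B : Op n)ᴴ * (B : Op n) = 1 := Matrix.mem_unitaryGroup_iff'.mp B.2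

theorem IsEigenbasis.sq_eq_one (h : IsEigenbasis O B o) (hOO : O * O = 1) (k : Qubits n) :
    o k ^ 2 = 1 := by
  have h1 : (B : Op n) * (Matrix.diagonal (fun k => (o k : ℂ)) *
      Matrix.diagonal (fun k => (o k : ℂ))) = B := by
    rw [← mul_assoc, ← h, mul_assoc, ← h, ← mul_assoc, hOO, one_mul]
  have h2 := congrArg (fun M => (B : Op n)ᴴ * M) h1
  simp only [← mul_assoc, unitaryGroup_conjTranspose_mul, one_mul] at h2
  rw [Matrix.diagonal_mul_diagonal] at h2
  have h3 := congrFun (congrFun h2 k) k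
  rw [Matrix.diagonal_apply_eq, Matrix.one_apply_eq] at h3
  rw [sq]
  exact_mod_cast h3

theorem sum_bornProb (B : Matrix.unitaryGroup (Qubits n) ℂ) {ρ : Op n} (hρ : ρ.trace = 1) :
    ∑ k, bornProb B ρ k = 1 := by
  have : ∑ k, bornProb B ρ k = (((B : Op n)ᴴ * ρ * B).trace).re := by
    simp [bornProb, Matrix.trace]
  rw [this, trace_conj_eq (unitaryGroup_conjTranspose_mul B), hρ, Complex.one_re]

theorem IsEigenbasis.sum_bornProb_mul (h : IsEigenbasis O B o) (ρ : Op n) :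
    ∑ k, bornProb B ρ k * o k = (ρ * O).trace.re := by
  have h1 : (((B : Op n)ᴴ * ρ * B) * Matrix.diagonal (fun k => (o k : ℂ))).trace =
      (ρ * O).trace := by
    rw [← trace_conj_eq (unitaryGroup_conjTranspose_mul B) (ρ * O), mul_assoc, ← h]
    simp only [mul_assoc]
  rw [← h1]
  simp [bornProb, Matrix.trace, Matrix.mul_diagonal]

/-- The trace is the mean of outcomes ±1 under the Born probabilities, which are nonnegative and sum
to 1. -/
theorem IsEigenbasis.abs_trace_le (h : IsEigenbasis O B o) (hOO : O * O = 1) {ρ : Op n}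
    (hρ : IsDensity ρ) : |(ρ * O).trace.re| ≤ 1 := by
  rw [← h.sum_bornProb_mul, ← sum_bornProb B hρ.2]
  refine (Finset.abs_sum_le_sum_abs _ _).trans (Finset.sum_le_sum fun k _ => ?_)
  have h0 : 0 ≤ bornProb B ρ k :=
    (Complex.le_def.mp (hρ.1.conjTranspose_mul_mul_same (B : Op n)).diag_nonneg).1
  rw [abs_mul, abs_of_nonneg h0]
  exact mul_le_of_le_one_right h0 ((sq_le_one_iff_abs_le_one _).mp (h.sq_eq_one hOO k).le)

end Born

theorem two_le_two_pow_of_nontrivial {n : ℕ} [Nontrivial (Qubits n)] : (2 : ℝ) ≤ 2 ^ n := by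
  apply two_le_two_pow
  by_contra h
  have h1 := one_lt_two_pow_of_nontrivial (n := n)
  simp [show n = 0 by omega] at h1

namespace PauliCircuit

variable {n m : ℕ} (c : PauliCircuit n m) {μ : Measure (Fin m → ℝ)}

theorem memLp_value_shift [IsProbabilityMeasure μ] {O : Op n} (hO : Oᴴ = O)
    (hOO : O * O = 1) (s : Fin m → ℝ) : MemLp (fun θ => c.value O (θ + s)) ⊤ μ :=
  memLp_top_of_bound
    ((c.continuous_value O).comp (continuous_id.add continuous_const)).aestronglyMeasurable 1 <|
    Filter.Eventually.of_forall fun θ => c.abs_value_le (by rw [hO, hOO]) _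

/-- The mean-squared error of the scaled parameter-shift schemes. -/
theorem mse_eq [Nontrivial (Qubits n)] [IsProbabilityMeasure μ] {O : Op n}
    (hO : Oᴴ = O) (hOO : O * O = 1) (hO0 : O.trace = 0) {comp : Component m} (h : c.TDS μ comp)
    {B : Matrix.unitaryGroup (Qubits n) ℂ} {o : Qubits n → ℝ} (hB : IsEigenbasis O B o)
    {N : ℕ} (hN : 1 ≤ N) {η : ℝ} {ρerr : Op n} {ρ : (Fin m → ℝ) → Op n} (he : ρerr.trace = 1)
    (hρ : ∀ θ, ρ θ = ((1 - η : ℝ) : ℂ) • c.state θ + (η : ℂ) • ρerr) (lam : ℝ) :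
    mse c μ O B o ρ comp N lam =
      quadraticError (2 ^ n) η (ρerr * O).trace.re (Component.meanSquare (2 ^ n) comp.kind)
        (comp.stencil.size * N / (4 * 2 ^ n * criticalPrefactor (2 ^ n) comp.kind)) lam := by
  set g := (ρerr * O).trace.re with hg
  have hd := one_lt_two_pow_of_nontrivial (n := n)
  have hρ1 : ∀ θ, (ρ θ).trace = 1 := fun θ => by
    rw [hρ, Matrix.trace_add, Matrix.trace_smul, Matrix.trace_smul, c.state_trace, he]
    push_cast
    simp
  have hF : ∀ θ, ∑ k, bornProb B (ρ θ) k * o k = (1 - η) * c.value O θ + η * g := fun θ => by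
    rw [hB.sum_bornProb_mul, hρ, add_mul, smul_mul_assoc, smul_mul_assoc, Matrix.trace_add,
      Matrix.trace_smul, Matrix.trace_smul, ← c.value_eq hO, hg]
    simp
  have hD := fun θ => (c.isTrig_value O).trueValue_eq comp θ
  -- At fixed θ, the average over the data splits into variance plus squared bias.
  have hint : ∀ θ, ∑ x : Fin comp.stencil.size → Fin N → Qubits n,
      (∏ a, ∏ j, bornProb B (ρ (θ + comp.stencil.shift a)) (x a j)) *
        (lam * ∑ a, comp.stencil.weight a * sampleMean o (x a)
          - comp.trueValue (c.value O) θ) ^ 2 =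
      lam ^ 2 / N * ∑ a, comp.stencil.weight a ^ 2 *
        (1 - η ^ 2 * g ^ 2 - 2 * (1 - η) * η * g * c.value O (θ + comp.stencil.shift a) -
          (1 - η) ^ 2 * c.value O (θ + comp.stencil.shift a) ^ 2) +
      (lam * (1 - η) - 1) ^ 2 * comp.trueValue (c.value O) θ ^ 2 := fun θ => by
    rw [sum_data_sq comp.stencil.weight (fun a => bornProb B (ρ (θ + comp.stencil.shift a)))
      (fun a => sum_bornProb B (hρ1 _)) (hB.sq_eq_one hOO) hN]
    simp only [hF]
    congr 1
    · congr 1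
      exact Finset.sum_congr rfl fun a _ => by ring
    · rw [← mul_pow]
      congr 1
      -- The offset ηg is multiplied by the sum of the weights, which is zero.
      have : ∑ a, comp.stencil.weight a *
          ((1 - η) * c.value O (θ + comp.stencil.shift a) + η * g) =
          (1 - η) * ∑ a, comp.stencil.weight a * c.value O (θ + comp.stencil.shift a) +
            η * g * ∑ a, comp.stencil.weight a := by
        rw [Finset.mul_sum, Finset.mul_sum, ← Finset.sum_add_distrib]
        exact Finset.sum_congr rfl fun a _ => by ring
      rw [this, ← hD, comp.sum_weight]
      ring
  have hv := fun s => c.memLp_value_shift (μ := μ) hO hOO s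
  have hv1 := fun s => (hv s).integrable le_top
  have hv2 : ∀ s, Integrable (fun θ => c.value O (θ + s) ^ 2) μ := fun s => by
    simp only [sq]
    exact ((hv s).mul (r := ⊤) (hv s)).integrable le_top
  have hDi : Integrable (fun θ => comp.trueValue (c.value O) θ ^ 2) μ := by
    have hDm : MemLp (fun θ => comp.trueValue (c.value O) θ) ⊤ μ := by
      simp only [hD]
      exact memLp_finsetSum _ fun a _ => (hv _).const_mul _
    simp only [sq]
    exact (hDm.mul (r := ⊤) hDm).integrable le_top
  have hterm : ∀ s, Integrable (fun θ => 1 - η ^ 2 * g ^ 2 -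
      2 * (1 - η) * η * g * c.value O (θ + s) - (1 - η) ^ 2 * c.value O (θ + s) ^ 2) μ := fun s =>
    ((integrable_const _).sub ((hv1 s).const_mul _)).sub ((hv2 s).const_mul _)
  -- With E f = 0 and E f² = 1/(d+1), the mean outcome variance is 1 - η²g² - (1-η)²/(d+1) =
  -- q/(d+1), the same at every shifted point.
  have hval : ∀ a, ∫ θ, (1 - η ^ 2 * g ^ 2 -
      2 * (1 - η) * η * g * c.value O (θ + comp.stencil.shift a) -
        (1 - η) ^ 2 * c.value O (θ + comp.stencil.shift a) ^ 2) ∂μ =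
      varianceFactor (2 ^ n) η g / (2 ^ n + 1) := fun a => by
    have h12 : Integrable (fun θ => 1 - η ^ 2 * g ^ 2 -
      2 * (1 - η) * η * g * c.value O (θ + comp.stencil.shift a)) μ :=
        (integrable_const _).sub ((hv1 _).const_mul _)
    rw [integral_sub h12 ((hv2 _).const_mul _),
      integral_sub (integrable_const _) ((hv1 _).const_mul _), integral_const_mul,
      integral_const_mul, c.integral_value_shift hO hO0 h.cutIndep h.isTwoDesign
        (comp.shift_eq_zero a), c.integral_value_shift_sq hO hOO hO0 h.cutIndep h.isTwoDesign
        (comp.shift_eq_zero a)]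
    simp only [integral_const, probReal_univ, one_smul, varianceFactor]
    field_simp
    ring
  unfold mse
  simp only [hint]
  have hs1 : Integrable (fun θ => ∑ a, comp.stencil.weight a ^ 2 *
        (1 - η ^ 2 * g ^ 2 - 2 * (1 - η) * η * g * c.value O (θ + comp.stencil.shift a) -
          (1 - η) ^ 2 * c.value O (θ + comp.stencil.shift a) ^ 2)) μ :=
    integrable_finsetSum _ fun a _ => (hterm _).const_mul _
  rw [integral_add (hs1.const_mul _) (hDi.const_mul _), integral_const_mul, integral_const_mul,
    integral_finsetSum _ fun a _ => (hterm _).const_mul _,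
    c.integral_trueValue_sq hO hOO hO0 h]
  simp only [integral_const_mul, hval, ← Finset.sum_mul]
  have hw := comp.sum_weight_sq hd
  have hN0 : (0 : ℝ) < N := by exact_mod_cast hN
  have hsz := comp.size_pos
  have hM := Component.meanSquare_pos hd comp.kind
  have hp := (criticalPrefactor_mem (two_le_two_pow_of_nontrivial (n := n)) comp.kind).1
  unfold quadraticError
  have hW : ∑ a, comp.stencil.weight a ^ 2 = 4 * criticalPrefactor (2 ^ n) comp.kind *
      Component.meanSquare (2 ^ n) comp.kind * (2 ^ n + 1) / comp.stencil.size := by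
    rw [← hw]
    field_simp
  rw [hW]
  generalize criticalPrefactor (2 ^ n) comp.kind = p at *
  have hp0 : 0 < p := by linarith
  field_simp

end PauliCircuit

/-! ### Assembly of the claims. -/

theorem lemma1 :
    -- the comparison of the two schemes, for every circuit, noise and component
    (∀ (n m : ℕ) (c : PauliCircuit n m) (μ : Measure (Fin m → ℝ)) (_ : IsProbabilityMeasure μ)
      (s : Fin n → Option Axis) (_ : ∃ q, s q ≠ none)
      (B : Matrix.unitaryGroup (Qubits n) ℂ) (o : Qubits n → ℝ)
      (_ : IsEigenbasis (pauliString s) B o)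
      (comp : Component m) (_ : c.TDS μ comp) (N : ℕ) (_ : 1 ≤ N),
      let NT : ℝ := comp.stencil.size * N
      let lam : ℝ := lamOpt (2 ^ n) NT comp.kind
      -- the scaling is the one that is optimal without noise
      (∀ lam' : ℝ, lam' ≠ lam →
        mse c μ (pauliString s) B o c.state comp N lam <
          mse c μ (pauliString s) B o c.state comp N lam') ∧
      ∀ (η : ℝ) (_ : 0 ≤ η) (_ : η ≤ 1) (ρerr : Op n) (ρ : (Fin m → ℝ) → Op n)
        (_ : c.HasConstantErrorTerm η ρerr ρ),
        let g : ℝ := (ρerr * pauliString s).trace.re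
        let nsps : ℝ := mse c μ (pauliString s) B o ρ comp N lam
        let ps : ℝ := mse c μ (pauliString s) B o ρ comp N 1
        (0 < η → η < 1 →
          (nsps < ps ↔ NT < critical n η g comp.kind) ∧
          (nsps = ps ↔ NT = critical n η g comp.kind)) ∧
        (η = 0 ∨ (η = 1 ∧ |g| < 1) → nsps < ps)) ∧
    -- the closed form for a vanishing error term
    (∀ (n : ℕ) (η : ℝ) (κ : Kind), 1 ≤ n → 0 < η → η < 1 →
      critical n η 0 κ = criticalOf (2 ^ n) η (hZero (2 ^ n) η) κ) ∧
    -- the behaviour to leading order in small error rates, uniformly in the number of qubits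
    (∃ C : ℝ, ∀ (n : ℕ) (η g : ℝ) (κ : Kind), 1 ≤ n → 0 < η → η ≤ 1 / 2 → |g| ≤ 1 →
      |critical n η g κ - criticalLeading n η κ| ≤ C * 2 ^ n) ∧
    -- the growth with the number of qubits and the inverse error rate
    (∃ c₁ c₂ : ℝ, 0 < c₁ ∧ ∀ (n : ℕ) (η g : ℝ) (κ : Kind), 1 ≤ n → 0 < η → η < 1 → |g| ≤ 1 →
      c₁ * (2 ^ n / η) ≤ critical n η g κ ∧
      critical n η g κ ≤ c₂ * (2 ^ n / (η * (1 - η)))) := by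
  refine ⟨?_, fun n η κ _ _ _ => critical_eq_of_vanishing_error n η κ,
    ⟨100, fun n η g κ hn h0 h1 hg => abs_critical_sub_leading_le n η g κ hn h0 h1 hg⟩,
    ⟨3 / 8, 100, by norm_num, fun n η g κ hn h0 h1 hg => critical_growth n η g κ hn h0 h1 hg⟩⟩
  intro n m c μ _ s hs B o hB comp hT N hN NT lam
  -- The non-identity factor of the string provides a qubit, so d ≥ 2.
  have : Nonempty (Fin n) := ⟨hs.choose⟩
  have : Nontrivial (Qubits n) := inferInstance
  have hO := pauliString_conjTranspose s
  have hOO := pauliString_mul_self s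
  have hO0 := pauliString_trace hs
  have hd2 := two_le_two_pow_of_nontrivial (n := n)
  have hd : (0 : ℝ) < 2 ^ n := by positivity
  have hNT : 0 < NT := mul_pos comp.size_pos (by exact_mod_cast hN)
  have hM := Component.meanSquare_pos (one_lt_two_pow_of_nontrivial (n := n)) comp.kind
  have hp : 0 < criticalPrefactor (2 ^ n) comp.kind := by
    linarith [(criticalPrefactor_mem hd2 comp.kind).1]
  have hy : 0 < NT / (4 * 2 ^ n * criticalPrefactor (2 ^ n) comp.kind) := by positivity
  have hlam : lam = _ := lamOpt_eq hd2 hNT comp.kind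
  constructor
  · intro lam' hne
    -- The noiseless circuit is the case η = 0; any operator of trace one can serve as the error
    -- term.
    have hρ : ∀ θ, c.state θ = ((1 - (0 : ℝ) : ℝ) : ℂ) • c.state θ + ((0 : ℝ) : ℂ) • c.state 0 :=
      fun θ => by simp
    rw [c.mse_eq hO hOO hO0 hT hB hN (c.state_trace 0) hρ,
      c.mse_eq hO hOO hO0 hT hB hN (c.state_trace 0) hρ]
    rw [hlam] at hne ⊢
    exact quadraticError_noiseless_lt hd hM hy _ hne
  · intro η h0 h1 ρerr ρ hρ g nsps ps
    have hg : |g| ≤ 1 := hB.abs_trace_le hOO hρ.1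
    have hn : nsps = quadraticError (2 ^ n) η g (Component.meanSquare (2 ^ n) comp.kind)
        (NT / (4 * 2 ^ n * criticalPrefactor (2 ^ n) comp.kind)) lam :=
      c.mse_eq hO hOO hO0 hT hB hN hρ.1.2 hρ.2 lam
    have hs : ps = quadraticError (2 ^ n) η g (Component.meanSquare (2 ^ n) comp.kind)
        (NT / (4 * 2 ^ n * criticalPrefactor (2 ^ n) comp.kind)) 1 :=
      c.mse_eq hO hOO hO0 hT hB hN hρ.1.2 hρ.2 1
    rw [hn, hs, hlam, critical, criticalOf_eq]
    exact ⟨fun h0 h1 => quadraticError_compare hd hM hNT hp hg h0 h1,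
      fun h => quadraticError_lt_of_extreme hd hM hy h⟩
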